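/- There is an absolute constant $C>0$ with the following property. Let $E$ be a real separable Hilbert space, let $k,N\ge 1$ be integers, $M\ge 0$ and $\delta\in(0,1)$. A quantizer is a non-empty set $A\subset E$ with $|A|\le k$; let $\mathcal A^k_M$ be the set of quantizers all of whose points have norm at most $M$. Put $l_A(x)=\min_{a\in A}\bigl(-2\langle x,a\rangle+\|a\|^2\bigr)$, $\ell=8\lceil\log(2/\delta)\rceil+1$ and $m=\lfloor N/\ell\rfloor$. For a sample $X_1,\dots,X_N\in E$ and $f:E\to\mathbb R$ let $$\mathrm{MOM}(f)=\mathrm{Median}\Bigl(\frac1m\sum_{i\in I_1}f(X_i),\dots,\frac1m\sum_{i\in I_\ell}f(X_i)\Bigr),\qquad I_j=\{(j-1)m+1,\dots,jm\},$$ with the convention $\mathrm{MOM}(f)=0$ if $N<\ell$ (so $m=N/\ell$ whenever $\ell$ divides $N$; otherwise the last $N-\ell m$ observations are not used). Then on every sample the function $A\mapsto \mathrm{MOM}(l_A)$ attains its minimum over $\mathcal A^k_M$. Let $\hat A_{\delta,M}=\hat A_{\delta,M}(X_1,\dots,X_N)$ be any choice of a minimizer. Let $P$ be a Borel probability measure on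 $E$ and let $X$ have law $P$, with $\mathbb E\|X\|^2<\infty$. Put $D(A)=\mathbb E\min_{a\in A}\|X-a\|^2$, and let $A^*$ be an optimal quantizer, that is, a minimizer of $D$ over all quantizers with at most $k$ points, such that $\|a\|\le M$ for all $a\in A^*$. If $X_1,\dots,X_N$ are independent with law $P$, then, with probability at least $1-\delta$, $$D(\hat A_{\delta,M})-D(A^*)\le C\,M\Bigl(M+\sqrt{\mathbb E\|X\|^2}\Bigr)\left(\frac{k}{\sqrt N}+\sqrt{\frac{\log(1/\delta)}{N}}\right).$$ Here, so that no measurability of the choice is needed, "with probability at least $1-\delta$" means that the set where the inequality fails has outer measure at most $\delta$. -/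

import Mathlib

open MeasureTheory ProbabilityTheory

namespace KMeans

section Quantizers

variable {E : Type*} [NormedAddCommGroup E] [InnerProductSpace ℝ E]

/-- The quantizers with at most `k` centres: non-empty finite subsets of `E` with at most `k`
elements. -/
def quantizers (E : Type*) (k : ℕ) : Set (Finset E) :=
  {A | A.Nonempty ∧ A.card ≤ k}

/-- The quantizers with at most `k` centres, all of them in the closed ball of radius `M` around
the origin. -/
def boundedQuantizers (E : Type*) [NormedAddCommGroup E] (k : ℕ) (M : ℝ) : Set (Finset E) :=
  {A | A ∈ quantizers E k ∧ ∀ a ∈ A, ‖a‖ ≤ M}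

/-- The distortion `D(A) = E min_{a ∈ A} ‖X - a‖²` of a quantizer `A`, for `X` with law `P`.
(The infimum is over a finite set, which is non-empty whenever `A` is a quantizer.) -/
noncomputable def distortion [MeasurableSpace E] (P : Measure E) (A : Finset E) : ℝ :=
  ∫ x, (⨅ a : A, ‖x - (a : E)‖ ^ 2) ∂P

/-- `A` minimizes the distortion among all quantizers with at most `k` centres. -/
def IsOptimal [MeasurableSpace E] (P : Measure E) (k : ℕ) (A : Finset E) : Prop :=
  A ∈ quantizers E k ∧ IsMinOn (distortion P) (quantizers E k) A

/-- The loss `l_A(x) = min_{a ∈ A} (-2 ⟨x, a⟩ + ‖a‖²)`. -/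
noncomputable def loss (A : Finset E) (x : E) : ℝ :=
  ⨅ a : A, (-2 * inner ℝ x (a : E) + ‖(a : E)‖ ^ 2)

end Quantizers

section MedianOfMeans

/-- The median of `y 0, …, y (ℓ - 1)`: the `⌈ℓ / 2⌉`-th smallest of these numbers, counted with
multiplicity. In zero-based numbering this is entry `(ℓ - 1) / 2` of the sorted sequence. -/
noncomputable def median {ℓ : ℕ} [NeZero ℓ] (y : Fin ℓ → ℝ) : ℝ :=
  y (Tuple.sort y ⟨(ℓ - 1) / 2,
    lt_of_le_of_lt (Nat.div_le_self _ _) (Nat.sub_lt (NeZero.pos ℓ) Nat.one_pos)⟩)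

/-- The block `{j m, …, (j + 1) m - 1}` of sample indices (zero-based numbering), for block
length `m`. -/
def block {N : ℕ} (m j : ℕ) : Finset (Fin N) :=
  {i | j * m ≤ (i : ℕ) ∧ (i : ℕ) < (j + 1) * m}

/-- The median of means of the function `f` over the sample `x`, with `ℓ` consecutive blocks of
equal length `⌊N / ℓ⌋`. If `ℓ` does not divide `N`, then the last `N % ℓ` observations are not
used; if `N < ℓ`, then all blocks are empty and the value is `0`. -/
noncomputable def medianOfMeans {E : Type*} {N : ℕ} (ℓ : ℕ) [NeZero ℓ] (x : Fin N → E)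
    (f : E → ℝ) : ℝ :=
  median fun j : Fin ℓ => ((N / ℓ : ℕ) : ℝ)⁻¹ * ∑ i ∈ block (N / ℓ) j, f (x i)

/-- The number of blocks, `8 ⌈log (2 / δ)⌉ + 1`, for the confidence level `1 - δ`. -/
noncomputable def numBlocks (δ : ℝ) : ℕ := 8 * ⌈Real.log (2 / δ)⌉₊ + 1

instance (δ : ℝ) : NeZero (numBlocks δ) := ⟨Nat.succ_ne_zero _⟩

/-- `A` is a value of the estimator on the sample `x`: it minimizes `A ↦ MOM(l_A)` among the
quantizers with at most `k` centres, all in the ball of radius `M`. -/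
def IsMOMMinimizer {E : Type*} [NormedAddCommGroup E] [InnerProductSpace ℝ E] {N : ℕ}
    (k : ℕ) (M δ : ℝ) (x : Fin N → E) (A : Finset E) : Prop :=
  A ∈ boundedQuantizers E k M ∧
    IsMinOn (fun B => medianOfMeans (numBlocks δ) x (loss B)) (boundedQuantizers E k M) A

end MedianOfMeans

end KMeans

/-! Since `‖x - a‖ ^ 2 = ‖x‖ ^ 2 + centreLoss a x`, distortions of quantizers differ by their
expected losses. Minimality of the estimator then bounds the excess distortion by twice the largest
gap between median of means and expectation over the quantizers in the ball. That gap is at most `r`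
when fewer than half of the block means deviate by more than `r` (`abs_median_sub_le`), so the task
is to count deviating blocks uniformly over quantizers.

With `dev j` the deviation of block `j`, the count is at most `∑ j, min 1 (|dev j| / r)`, whose
summands lie in `[0, 1]` however heavy the tails of the data; this is why second moments suffice. By
bounded differences (`measure_ciSup_ge_le`) its supremum exceeds its mean by `ℓ / 4` with
probability at most `exp (-ℓ / 8) ≤ δ`. The mean is handled in `integral_ciSup_truncated_le`:
symmetrize over the blocks, contract the truncation away, symmetrize again inside the blocks. What
remains is the mean deviation of one block and a Rademacher complexity. The latter is subadditive
under minima (`rademacher_min_le`), so `k` centres cost `k` times one centre, and one centre is a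
Hilbert space estimate (`rademacher_centreLoss_le`). Making both terms small compared with `ℓ`
dictates `accuracy`.

These comparisons concern finite classes; a dense sequence of tuples extends them to the whole ball
(`measure_exists_tuple_le`). A minimizer exists because projecting the centres to the span of the
sample does not increase the losses there, and balls of that span are compact. -/

namespace KMeans

/-! ### Finite suprema: order and integrability. -/

section FiniteSuprema

variable {ι β γ : Type*} [MeasurableSpace β] [MeasurableSpace γ] [Finite ι]

theorem le_ciSup_of_finite (u : ι → ℝ) (a : ι) : u a ≤ ⨆ a, u a :=
  le_ciSup (Set.finite_range u).bddAbove a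

theorem ciSup_mono_of_finite {u v : ι → ℝ} (h : ∀ a, u a ≤ v a) : ⨆ a, u a ≤ ⨆ a, v a :=
  ciSup_mono (Set.finite_range v).bddAbove h

variable [Nonempty ι]

theorem abs_ciSup_le_sum {ι : Type*} [Fintype ι] [Nonempty ι] (u : ι → ℝ) :
    |⨆ a, u a| ≤ ∑ a, |u a| := by
  obtain ⟨a, ha⟩ := exists_eq_ciSup_of_finite (f := u)
  rw [← ha]
  exact Finset.single_le_sum (f := fun a => |u a|) (fun i _ => abs_nonneg _) (Finset.mem_univ a)

theorem integrable_ciSup {ν : Measure β} {g : ι → β → ℝ} (hg : ∀ a, Integrable (g a) ν) :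
    Integrable (fun y => ⨆ a, g a y) ν := by
  have := Fintype.ofFinite ι
  refine Integrable.mono' (g := fun y => ∑ a, |g a y|)
    (integrable_finsetSum _ fun a _ => (hg a).abs)
    (AEMeasurable.iSup fun a => (hg a).aemeasurable).aestronglyMeasurable
    (Filter.Eventually.of_forall fun y => abs_ciSup_le_sum _)

theorem integrable_ciSup_const_add {ν : Measure β} [IsFiniteMeasure ν] {g : ι → β → ℝ}
    (hg : ∀ a, Integrable (g a) ν) (u : ι → ℝ) :
    Integrable (fun y => ⨆ a, (u a + g a y)) ν :=
  integrable_ciSup fun a => (integrable_const _).add (hg a)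

theorem integrable_ciSup_const_sub {ν : Measure β} [IsFiniteMeasure ν] {g : ι → β → ℝ}
    (hg : ∀ a, Integrable (g a) ν) (u : ι → ℝ) :
    Integrable (fun y => ⨆ a, (u a - g a y)) ν :=
  integrable_ciSup fun a => (integrable_const _).sub (hg a)

theorem ciSup_add_le (u v : ι → ℝ) : ⨆ a, (u a + v a) ≤ (⨆ a, u a) + ⨆ a, v a :=
  ciSup_le fun a => add_le_add (le_ciSup_of_finite u a) (le_ciSup_of_finite v a)

end FiniteSuprema

/-! ### Splitting off one coordinate of a product measure. -/

section ProductMeasures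

variable {β F : Type*} [MeasurableSpace β] [NormedAddCommGroup F]

theorem measurePreserving_cons (ν : Measure β) [SigmaFinite ν] (n : ℕ) :
    MeasurePreserving (fun p : β × (Fin n → β) => (Fin.cons p.1 p.2 : Fin (n + 1) → β))
      (ν.prod (Measure.pi fun _ => ν)) (Measure.pi fun _ => ν) := by
  have := (measurePreserving_piFinSuccAbove (fun _ : Fin (n + 1) => ν) 0).symm
  convert this using 1
  ext p i
  simp [MeasurableEquiv.piFinSuccAbove]

theorem measurableEmbedding_cons (n : ℕ) :
    MeasurableEmbedding (fun p : β × (Fin n → β) => (Fin.cons p.1 p.2 : Fin (n + 1) → β)) := by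
  have := (MeasurableEquiv.piFinSuccAbove (fun _ : Fin (n + 1) => β) 0).symm.measurableEmbedding
  convert this using 1
  ext p i
  simp [MeasurableEquiv.piFinSuccAbove]

theorem integrable_comp_cons {ν : Measure β} [SigmaFinite ν] {n : ℕ}
    {G : (Fin (n + 1) → β) → F} (hG : Integrable G (Measure.pi fun _ => ν)) :
    Integrable (fun p : β × (Fin n → β) => G (Fin.cons p.1 p.2))
      (ν.prod (Measure.pi fun _ => ν)) :=
  (measurePreserving_cons ν n).integrable_comp_of_integrable hG

theorem integral_pi_succ [NormedSpace ℝ F] {ν : Measure β} [SigmaFinite ν] {n : ℕ}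
    {G : (Fin (n + 1) → β) → F} (hG : Integrable G (Measure.pi fun _ => ν)) :
    ∫ y, G y ∂(Measure.pi fun _ => ν) =
      ∫ x, ∫ y, G (Fin.cons x y) ∂(Measure.pi fun _ => ν) ∂ν := by
  rw [← (measurePreserving_cons ν n).integral_comp (measurableEmbedding_cons n),
    integral_prod _ (integrable_comp_cons hG)]

theorem integrable_pi_sum {ν : Measure β} [IsProbabilityMeasure ν] {n : ℕ} {g : β → F}
    (hg : Integrable g ν) :
    Integrable (fun y : Fin n → β => ∑ i, g (y i)) (Measure.pi fun _ => ν) :=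
  integrable_finsetSum _ fun i _ => integrable_comp_eval (μ := fun _ => ν) (i := i) hg

end ProductMeasures

/-! ### Comparison of expected suprema and its tensorization. -/

section Comparison

variable {ι β γ η : Type*} [MeasurableSpace β] [MeasurableSpace γ] [MeasurableSpace η]

/-- The process `g` under `ν` has smaller expected suprema than the process `h` under `ρ`,
uniformly over all deterministic shifts. -/
def SupLE (ν : Measure β) (g : ι → β → ℝ) (ρ : Measure γ) (h : ι → γ → ℝ) : Prop :=
  ∀ u : ι → ℝ, ∫ y, (⨆ a, (u a + g a y)) ∂ν ≤ ∫ z, (⨆ a, (u a + h a z)) ∂ρ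

theorem SupLE.trans {ν : Measure β} {g : ι → β → ℝ} {ρ : Measure γ} {h : ι → γ → ℝ}
    {τ : Measure η} {l : ι → η → ℝ} (h₁ : SupLE ν g ρ h) (h₂ : SupLE ρ h τ l) :
    SupLE ν g τ l := fun u => (h₁ u).trans (h₂ u)

theorem SupLE.integral_le {ν : Measure β} {g : ι → β → ℝ} {ρ : Measure γ} {h : ι → γ → ℝ}
    (H : SupLE ν g ρ h) : ∫ y, (⨆ a, g a y) ∂ν ≤ ∫ z, (⨆ a, h a z) ∂ρ := by
  simpa using H 0

variable [Finite ι] [Nonempty ι]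

/-- Comparison of expected suprema passes to sums of independent copies. -/
theorem SupLE.pi {ν : Measure β} {g : ι → β → ℝ} {ρ : Measure γ} {h : ι → γ → ℝ}
    [IsProbabilityMeasure ν] [IsProbabilityMeasure ρ]
    (H : SupLE ν g ρ h) (hg : ∀ a, Integrable (g a) ν) (hh : ∀ a, Integrable (h a) ρ) (n : ℕ) :
    SupLE (Measure.pi fun _ : Fin n => ν) (fun a y => ∑ i, g a (y i))
      (Measure.pi fun _ : Fin n => ρ) (fun a z => ∑ i, h a (z i)) := by
  induction n with
  | zero => intro u; simp
  | succ n ih =>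
    intro u
    have hG : ∀ n, Integrable (fun y : Fin n → β => ⨆ a, (u a + ∑ i, g a (y i)))
        (Measure.pi fun _ => ν) := fun n =>
      integrable_ciSup_const_add (fun a => integrable_pi_sum (hg a)) u
    have hH : ∀ n, Integrable (fun y : Fin n → γ => ⨆ a, (u a + ∑ i, h a (y i)))
        (Measure.pi fun _ => ρ) := fun n =>
      integrable_ciSup_const_add (fun a => integrable_pi_sum (hh a)) u
    have hmix : Integrable (fun p : β × (Fin n → γ) =>
        ⨆ a, ((u a + g a p.1) + ∑ i, h a (p.2 i))) (ν.prod (Measure.pi fun _ => ρ)) :=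
      integrable_ciSup fun a => ((integrable_const _).add ((hg a).comp_fst _)).add
        ((integrable_pi_sum (hh a)).comp_snd _)
    have hG' := integrable_comp_cons (hG (n + 1))
    have hH' := integrable_comp_cons (hH (n + 1))
    rw [integral_pi_succ (hG (n + 1)), integral_pi_succ (hH (n + 1))]
    -- Coordinates are exchanged in two stages. With the others fixed, their contribution is a
    -- deterministic shift; this is why `SupLE` quantifies over all shifts.
    calc _ ≤ ∫ x, ∫ z, (⨆ a, ((u a + g a x) + ∑ i, h a (z i)))
          ∂(Measure.pi fun _ : Fin n => ρ) ∂ν := by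
          refine integral_mono hG'.integral_prod_left hmix.integral_prod_left fun x => ?_
          have := ih fun a => u a + g a x
          simpa [Fin.sum_univ_succ, add_assoc] using this
      _ = ∫ z, ∫ x, (⨆ a, ((u a + g a x) + ∑ i, h a (z i))) ∂ν
          ∂(Measure.pi fun _ : Fin n => ρ) := integral_integral_swap hmix
      _ ≤ _ := by
          refine le_of_le_of_eq ?_ (integral_integral_swap hH').symm
          refine integral_mono hmix.integral_prod_right hH'.integral_prod_right fun z => ?_
          have := H fun a => u a + ∑ i, h a (z i)
          simpa [Fin.sum_univ_succ, add_assoc, add_left_comm, add_comm] using this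

end Comparison

/-! ### Random signs: contraction and symmetrization. -/

section Rademacher

variable {ι β γ F : Type*} [MeasurableSpace β] [NormedAddCommGroup F]

/-- The law of `(X, σ)` where `X` has law `ν` and `σ` is an independent random sign. -/
noncomputable def signed (ν : Measure β) : Measure (β × ℝ) :=
  (2⁻¹ : ENNReal) • ν.map (fun x => (x, 1)) + (2⁻¹ : ENNReal) • ν.map (fun x => (x, -1))

instance (ν : Measure β) [IsProbabilityMeasure ν] : IsProbabilityMeasure (signed ν) := by
  constructor
  have h₁ : Measurable fun x : β => (x, (1 : ℝ)) := by fun_prop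
  have h₂ : Measurable fun x : β => (x, (-1 : ℝ)) := by fun_prop
  simp [signed, Measure.map_apply h₁, Measure.map_apply h₂, ENNReal.inv_two_add_inv_two]

theorem integrable_signed {ν : Measure β} {G : β × ℝ → F}
    (h₁ : Integrable (fun x => G (x, 1)) ν) (h₂ : Integrable (fun x => G (x, -1)) ν) :
    Integrable G (signed ν) := by
  refine Integrable.add_measure (Integrable.smul_measure ?_ (by simp))
    (Integrable.smul_measure ?_ (by simp))
  · exact (measurableEmbedding_prod_mk_right (1 : ℝ)).integrable_map_iff.2 h₁
  · exact (measurableEmbedding_prod_mk_right (-1 : ℝ)).integrable_map_iff.2 h₂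

theorem integral_signed [NormedSpace ℝ F] {ν : Measure β} {G : β × ℝ → F}
    (h₁ : Integrable (fun x => G (x, 1)) ν) (h₂ : Integrable (fun x => G (x, -1)) ν) :
    ∫ p, G p ∂(signed ν) = (2⁻¹ : ℝ) • (∫ x, G (x, 1) ∂ν + ∫ x, G (x, -1) ∂ν) := by
  have e₁ := measurableEmbedding_prod_mk_right (β := β) (1 : ℝ)
  have e₂ := measurableEmbedding_prod_mk_right (β := β) (-1 : ℝ)
  rw [signed, integral_add_measure ((e₁.integrable_map_iff.2 h₁).smul_measure (by simp))
    ((e₂.integrable_map_iff.2 h₂).smul_measure (by simp)), integral_smul_measure,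
    integral_smul_measure, e₁.integral_map, e₂.integral_map, smul_add]
  simp

theorem integrable_signed_smul [NormedSpace ℝ F] {ν : Measure β} {g : β → F}
    (hg : Integrable g ν) : Integrable (fun p : β × ℝ => p.2 • g p.1) (signed ν) :=
  integrable_signed (by simpa using hg) (by simpa using hg.neg)

theorem integral_signed_smul [NormedSpace ℝ F] {ν : Measure β} {g : β → F}
    (hg : Integrable g ν) : ∫ p, p.2 • g p.1 ∂(signed ν) = 0 := by
  rw [integral_signed (by simpa using hg) (by simpa using hg.neg)]
  simp [integral_neg]

variable [Finite ι] [Nonempty ι]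

theorem integral_signed_ciSup {ν : Measure β} [IsFiniteMeasure ν] {g : ι → β → ℝ}
    (hg : ∀ a, Integrable (g a) ν) (u : ι → ℝ) :
    ∫ p, (⨆ a, (u a + p.2 * g a p.1)) ∂(signed ν) =
      2⁻¹ * ∫ x, ((⨆ a, (u a + g a x)) + ⨆ a, (u a - g a x)) ∂ν := by
  have h₁ := integrable_ciSup_const_add hg u
  have h₂ := integrable_ciSup_const_add (fun a => (hg a).neg) u
  rw [integral_signed]
  · simp only [one_mul, neg_mul, ← sub_eq_add_neg, smul_eq_mul]
    rw [integral_add h₁ (by simpa [← sub_eq_add_neg] using h₂)]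
  · simpa using h₁
  · simpa using h₂

theorem SupLE.signed_neg {ν : Measure β} [IsFiniteMeasure ν] {g : ι → β → ℝ}
    (hg : ∀ a, Integrable (g a) ν) :
    SupLE (signed ν) (fun a p => p.2 * -g a p.1) (signed ν) (fun a p => p.2 * g a p.1) := by
  intro u
  have := integral_signed_ciSup (fun a => (hg a).neg) u
  simp only [Pi.neg_apply] at this
  rw [integral_signed_ciSup hg, this]
  simp [add_comm, ← sub_eq_add_neg]

/-- The contraction principle for one random sign. -/
theorem SupLE.signed_contraction {ν : Measure β} [IsFiniteMeasure ν] {g h : ι → β → ℝ}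
    (hg : ∀ a, Integrable (g a) ν) (hh : ∀ a, Integrable (h a) ν)
    (H : ∀ a b x, |g a x - g b x| ≤ |h a x - h b x|) :
    SupLE (signed ν) (fun a p => p.2 * g a p.1) (signed ν) (fun a p => p.2 * h a p.1) := by
  intro u
  rw [integral_signed_ciSup hg, integral_signed_ciSup hh]
  refine mul_le_mul_of_nonneg_left (integral_mono ?_ ?_ fun x => ?_) (by norm_num)
  · exact (integrable_ciSup_const_add hg u).add
      (integrable_ciSup_const_sub hg u)
  · exact (integrable_ciSup_const_add hh u).add
      (integrable_ciSup_const_sub hh u)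
  -- Pointwise in `x`: for near-maximizers `a`, `b` of the two suprema, `g a x - g b x` is at most
  -- `|h a x - h b x|`, and its sign decides which of `a`, `b` goes into which supremum on the
  -- right.
  · refine ciSup_add_ciSup_le fun a b => ?_
    have e₁ := le_ciSup_of_finite (fun a => u a + h a x) a
    have e₂ := le_ciSup_of_finite (fun a => u a - h a x) a
    have e₃ := le_ciSup_of_finite (fun a => u a + h a x) b
    have e₄ := le_ciSup_of_finite (fun a => u a - h a x) b
    have := H a b x
    have := le_abs_self (g a x - g b x)
    dsimp only at e₁ e₂ e₃ e₄ ⊢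
    cases abs_cases (h a x - h b x) <;> linarith

/-- Symmetrization of one centred variable. -/
theorem SupLE.signed_symm {ν : Measure β} [IsProbabilityMeasure ν] {g : ι → β → ℝ}
    (hg : ∀ a, Integrable (g a) ν) :
    SupLE ν (fun a x => g a x - ∫ y, g a y ∂ν) (signed ν) (fun a p => p.2 * (2 * g a p.1)) := by
  intro u
  have h2 : ∀ a, Integrable (fun x => 2 * g a x) ν := fun a => (hg a).const_mul 2
  rw [integral_signed_ciSup h2]
  have i₁ : Integrable (fun x => ⨆ a, (u a + 2 * g a x)) ν := integrable_ciSup_const_add h2 u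
  have i₂ : Integrable (fun x => ⨆ a, (u a - 2 * g a x)) ν := integrable_ciSup_const_sub h2 u
  set B := ∫ x, (⨆ a, (u a - 2 * g a x)) ∂ν with hB
  -- Splitting `u a` into halves separates `g a x` from the mean, each in its own supremum. Jensen's
  -- inequality treats the mean, and the factor `2` compensates for the halves.
  have key : ∀ x, (⨆ a, (u a + (g a x - ∫ y, g a y ∂ν))) ≤
      2⁻¹ * (⨆ a, (u a + 2 * g a x)) + 2⁻¹ * B := by
    intro x
    refine ciSup_le fun a => ?_
    have e₁ := le_ciSup_of_finite (fun a => u a + 2 * g a x) a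
    have e₂ : u a - 2 * ∫ y, g a y ∂ν ≤ B := by
      have : ∫ y, (u a - 2 * g a y) ∂ν ≤ B :=
        integral_mono ((integrable_const _).sub (h2 a)) i₂ fun y =>
          le_ciSup_of_finite (fun a => u a - 2 * g a y) a
      rwa [integral_sub (integrable_const _) (h2 a), integral_const_mul, integral_const,
        probReal_univ, one_smul] at this
    linarith
  calc _ ≤ ∫ x, (2⁻¹ * (⨆ a, (u a + 2 * g a x)) + 2⁻¹ * B) ∂ν :=
        integral_mono (integrable_ciSup_const_add
          (fun a => (hg a).sub (integrable_const _)) u)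
          ((i₁.const_mul _).add (integrable_const _)) key
    _ = _ := by
        rw [integral_add (i₁.const_mul _) (integrable_const _), integral_add i₁ i₂,
          integral_const_mul, integral_const, probReal_univ, one_smul, mul_add]

end Rademacher

/-! ### Second moments of sums of independent centred vectors. -/

section SecondMoments

variable {β H : Type*} [MeasurableSpace β] [NormedAddCommGroup H]

theorem memLp_pi_sum {ν : Measure β} [IsProbabilityMeasure ν] {Z : β → H} {p : ENNReal}
    (hZ : MemLp Z p ν) (n : ℕ) :
    MemLp (fun y : Fin n → β => ∑ i, Z (y i)) p (Measure.pi fun _ => ν) :=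
  memLp_finsetSum _ fun i _ =>
    hZ.comp_measurePreserving (measurePreserving_eval (fun _ : Fin n => ν) i)

theorem integral_norm_le_sqrt {ν : Measure β} [IsProbabilityMeasure ν] {Z : β → H}
    (hZ : MemLp Z 2 ν) : ∫ x, ‖Z x‖ ∂ν ≤ √(∫ x, ‖Z x‖ ^ 2 ∂ν) := by
  refine Real.le_sqrt_of_sq_le ?_
  have := variance_nonneg (fun x => ‖Z x‖) ν
  rw [variance_eq_sub hZ.norm] at this
  simpa using this

variable [InnerProductSpace ℝ H]

theorem integral_pi_sum {ν : Measure β} [IsProbabilityMeasure ν] {Z : β → H}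
    (hZ : Integrable Z ν) (n : ℕ) :
    ∫ y : Fin n → β, ∑ i, Z (y i) ∂(Measure.pi fun _ => ν) = n • ∫ x, Z x ∂ν := by
  rw [integral_finsetSum _ fun i _ => integrable_comp_eval (μ := fun _ => ν) (i := i) hZ]
  simp [integral_comp_eval (μ := fun _ : Fin n => ν) hZ.aestronglyMeasurable]

variable [CompleteSpace H]

/-- Second moments of independent centred variables add up. -/
theorem integral_norm_sq_pi_sum {ν : Measure β} [IsProbabilityMeasure ν] {Z : β → H}
    (hZ : MemLp Z 2 ν) (h0 : ∫ x, Z x ∂ν = 0) (n : ℕ) :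
    ∫ y : Fin n → β, ‖∑ i, Z (y i)‖ ^ 2 ∂(Measure.pi fun _ => ν) = n * ∫ x, ‖Z x‖ ^ 2 ∂ν := by
  induction n with
  | zero => simp
  | succ n ih =>
    have hi : Integrable Z ν := hZ.integrable (by norm_num)
    have hS := memLp_pi_sum hZ n
    have hS1 := hS.integrable (q := 2) (by norm_num)
    have hS2 := hS.integrable_norm_pow (p := 2) (by norm_num)
    have hZ2 := hZ.integrable_norm_pow (p := 2) (by norm_num)
    rw [integral_pi_succ ((memLp_pi_sum hZ (n + 1)).integrable_norm_pow (p := 2) (by norm_num))]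
    have key : ∀ x, ∫ y : Fin n → β, ‖∑ i, Z ((Fin.cons x y : Fin (n + 1) → β) i)‖ ^ 2
        ∂(Measure.pi fun _ => ν) = ‖Z x‖ ^ 2 + n * ∫ x, ‖Z x‖ ^ 2 ∂ν := by
      intro x
      simp only [Fin.sum_univ_succ, Fin.cons_zero, Fin.cons_succ, norm_add_sq_real]
      have hin : Integrable (fun y : Fin n → β => 2 * inner ℝ (Z x) (∑ i, Z (y i)))
          (Measure.pi fun _ => ν) := (hS1.const_inner (Z x)).const_mul 2
      have hadd : Integrable (fun y : Fin n → β => ‖Z x‖ ^ 2 + 2 * inner ℝ (Z x) (∑ i, Z (y i)))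
          (Measure.pi fun _ => ν) := (integrable_const _).add hin
      rw [integral_add hadd hS2, integral_add (integrable_const _) hin,
        integral_const_mul, integral_inner hS1, integral_pi_sum hi, h0, ih]
      simp
    simp only [key]
    rw [integral_add hZ2 (integrable_const _)]
    simp
    ring

theorem integral_norm_pi_sum_le {ν : Measure β} [IsProbabilityMeasure ν] {Z : β → H}
    (hZ : MemLp Z 2 ν) (h0 : ∫ x, Z x ∂ν = 0) (n : ℕ) :
    ∫ y : Fin n → β, ‖∑ i, Z (y i)‖ ∂(Measure.pi fun _ => ν) ≤
      √n * √(∫ x, ‖Z x‖ ^ 2 ∂ν) := by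
  rw [← Real.sqrt_mul (by positivity), ← integral_norm_sq_pi_sum hZ h0]
  exact integral_norm_le_sqrt (memLp_pi_sum hZ n)

end SecondMoments

/-! ### Bounded differences for suprema of empirical processes. -/

section Concentration

variable {ι β : Type*} [MeasurableSpace β] [Finite ι] [Nonempty ι]

/-- Hoeffding's lemma for a variable with values in an interval of length one. -/
theorem integral_exp_le_of_mem_Icc {ν : Measure β} [IsProbabilityMeasure ν] {G : β → ℝ}
    (hG : AEMeasurable G ν) {c : ℝ} (hc : ∀ x, G x ∈ Set.Icc c (c + 1)) (t : ℝ) :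
    ∫ x, Real.exp (t * G x) ∂ν ≤ Real.exp (t * (∫ x, G x ∂ν) + t ^ 2 / 8) := by
  have := (hasSubgaussianMGF_of_mem_Icc hG (Filter.Eventually.of_forall hc)).mgf_le t
  simp only [mgf, mul_sub, Real.exp_sub, integral_div] at this
  rw [div_le_iff₀ (Real.exp_pos _), ← Real.exp_add] at this
  refine this.trans (le_of_eq ?_)
  congr 1
  simp
  ring

theorem ciSup_mem_Icc (u : ι → ℝ) {n : ℕ} {s : ι → ℝ} (h : ∀ a, s a ∈ Set.Icc 0 (n : ℝ)) :
    ⨆ a, (u a + s a) ∈ Set.Icc (⨆ a, u a) ((⨆ a, u a) + n) := by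
  constructor
  · exact ciSup_mono_of_finite fun a => by linarith [(h a).1]
  · exact ciSup_le fun a => add_le_add (le_ciSup_of_finite u a) (h a).2

theorem sum_mem_Icc {β : Type*} {ψ : β → ℝ} (h : ∀ x, ψ x ∈ Set.Icc (0 : ℝ) 1) {n : ℕ} (y : Fin n → β) :
    ∑ i, ψ (y i) ∈ Set.Icc (0 : ℝ) n := by
  constructor
  · exact Finset.sum_nonneg fun i _ => (h _).1
  · simpa using Finset.sum_le_sum fun i (_ : i ∈ Finset.univ) => (h (y i)).2

/-- The exponential moment bound behind the bounded differences inequality, for suprema of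
empirical processes. -/
theorem integral_exp_ciSup_le {ν : Measure β} [IsProbabilityMeasure ν] {ψ : ι → β → ℝ}
    (hψ : ∀ a, Measurable (ψ a)) (h01 : ∀ a x, ψ a x ∈ Set.Icc (0 : ℝ) 1) (t : ℝ) (n : ℕ)
    (u : ι → ℝ) :
    ∫ y : Fin n → β, Real.exp (t * ⨆ a, (u a + ∑ i, ψ a (y i))) ∂(Measure.pi fun _ => ν) ≤
      Real.exp (t * (∫ y : Fin n → β, (⨆ a, (u a + ∑ i, ψ a (y i))) ∂(Measure.pi fun _ => ν))
        + n * (t ^ 2 / 8)) := by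
  induction n generalizing u with
  | zero => simp
  | succ n ih =>
    have hm : ∀ n (u : ι → ℝ), Measurable fun y : Fin n → β => ⨆ a, (u a + ∑ i, ψ a (y i)) :=
      fun n u => Measurable.iSup fun a => by fun_prop
    have hI : ∀ n (u : ι → ℝ), Integrable (fun y : Fin n → β => ⨆ a, (u a + ∑ i, ψ a (y i)))
        (Measure.pi fun _ => ν) := fun n u =>
      Integrable.of_mem_Icc _ _ (hm n u).aemeasurable
        (Filter.Eventually.of_forall fun y => ciSup_mem_Icc u fun a => sum_mem_Icc (h01 a) y)
    have hE : ∀ n (u : ι → ℝ),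
        Integrable (fun y : Fin n → β => Real.exp (t * ⨆ a, (u a + ∑ i, ψ a (y i))))
        (Measure.pi fun _ => ν) := fun n u =>
      integrable_exp_mul_of_mem_Icc (hm n u).aemeasurable
        (Filter.Eventually.of_forall fun y => ciSup_mem_Icc u fun a => sum_mem_Icc (h01 a) y)
    -- The conditional expectation given the first observation. It ranges over an interval of length
    -- one, so Hoeffding's lemma applies to it, while the induction hypothesis with shift `u a + ψ a
    -- x` treats the other observations.
    set G : β → ℝ := fun x => ∫ y : Fin n → β, (⨆ a, ((u a + ψ a x) + ∑ i, ψ a (y i)))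
      ∂(Measure.pi fun _ => ν) with hG
    have hcons : ∀ x (y : Fin n → β),
        (⨆ a, (u a + ∑ i, ψ a ((Fin.cons x y : Fin (n + 1) → β) i))) =
          ⨆ a, ((u a + ψ a x) + ∑ i, ψ a (y i)) := fun x y => by
      simp [Fin.sum_univ_succ, add_assoc]
    have hGI : Integrable G ν := by
      have := (integrable_comp_cons (hI (n + 1) u)).integral_prod_left
      simpa only [hcons] using this
    have hmem : ∀ x, G x ∈ Set.Icc (∫ y : Fin n → β, (⨆ a, (u a + ∑ i, ψ a (y i)))
        ∂(Measure.pi fun _ => ν)) ((∫ y : Fin n → β, (⨆ a, (u a + ∑ i, ψ a (y i)))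
        ∂(Measure.pi fun _ => ν)) + 1) := by
      intro x
      constructor
      · refine integral_mono (hI n u) (hI n _) fun y => ciSup_mono_of_finite fun a => ?_
        linarith [(h01 a x).1]
      · have : G x ≤ ∫ y : Fin n → β, ((⨆ a, (u a + ∑ i, ψ a (y i))) + 1)
            ∂(Measure.pi fun _ => ν) := by
          refine integral_mono (hI n _) ((hI n u).add (integrable_const _)) fun y => ?_
          refine ciSup_le fun a => ?_
          have := le_ciSup_of_finite (fun a => u a + ∑ i, ψ a (y i)) a
          dsimp only at this ⊢
          linarith [(h01 a x).2]
        rwa [integral_add (hI n u) (integrable_const _), integral_const, probReal_univ,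
          one_smul] at this
    have hGexp : Integrable (fun x => Real.exp (t * G x)) ν :=
      integrable_exp_mul_of_mem_Icc hGI.aemeasurable (Filter.Eventually.of_forall hmem)
    rw [integral_pi_succ (hE (n + 1) u), integral_pi_succ (hI (n + 1) u)]
    simp only [hcons]
    calc _ ≤ ∫ x, Real.exp (t * G x) * Real.exp (n * (t ^ 2 / 8)) ∂ν := by
          refine integral_mono ?_ (hGexp.mul_const _) fun x => ?_
          · simpa only [hcons] using (integrable_comp_cons (hE (n + 1) u)).integral_prod_left
          · simpa only [← Real.exp_add] using ih fun a => u a + ψ a x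
      _ ≤ Real.exp (t * (∫ x, G x ∂ν) + t ^ 2 / 8) * Real.exp (n * (t ^ 2 / 8)) := by
          rw [integral_mul_const]
          exact mul_le_mul_of_nonneg_right
            (integral_exp_le_of_mem_Icc hGI.aemeasurable hmem t) (Real.exp_pos _).le
      _ = _ := by
          rw [← Real.exp_add]
          congr 1
          push_cast
          ring

/-- The bounded differences inequality for suprema of empirical processes. -/
theorem measure_ciSup_ge_le {ν : Measure β} [IsProbabilityMeasure ν] {ψ : ι → β → ℝ}
    (hψ : ∀ a, Measurable (ψ a)) (h01 : ∀ a x, ψ a x ∈ Set.Icc (0 : ℝ) 1) (n : ℕ)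
    {s T : ℝ} (hs : 0 ≤ s)
    (hT : ∫ y : Fin n → β, (⨆ a, ∑ i, ψ a (y i)) ∂(Measure.pi fun _ => ν) + n * s ≤ T) :
    (Measure.pi fun _ : Fin n => ν).real {y | T ≤ ⨆ a, ∑ i, ψ a (y i)} ≤
      Real.exp (-(2 * n * s ^ 2)) := by
  have hm : Measurable fun y : Fin n → β => ⨆ a, ∑ i, ψ a (y i) :=
    Measurable.iSup fun a => by fun_prop
  -- `t = 4 * s` minimizes the exponent `-t * n * s + n * t ^ 2 / 8`.
  have h1 := measure_ge_le_exp_mul_mgf (μ := Measure.pi fun _ : Fin n => ν)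
    (X := fun y : Fin n → β => ⨆ a, ∑ i, ψ a (y i)) (t := 4 * s) T (by positivity)
    (integrable_exp_mul_of_mem_Icc hm.aemeasurable (Filter.Eventually.of_forall fun y => by
      simpa using ciSup_mem_Icc 0 fun a => sum_mem_Icc (h01 a) y))
  have h2 := integral_exp_ciSup_le (ν := ν) hψ h01 (4 * s) n 0
  simp only [Pi.zero_apply, zero_add] at h2
  refine h1.trans ((mul_le_mul_of_nonneg_left h2 (Real.exp_pos _).le).trans ?_)
  rw [← Real.exp_add]
  refine Real.exp_le_exp.2 ?_
  nlinarith

end Concentration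

/-! ### Block sums: removing block signs and bounding mean deviations. -/

section Blocks

variable {ι β : Type*} [MeasurableSpace β] [Finite ι] [Nonempty ι]

/-- Removal of the signs of the blocks: a signed centred block sum is dominated by the sum with
one sign for each observation. -/
theorem SupLE.signed_block {ν : Measure β} [IsProbabilityMeasure ν] {f : ι → β → ℝ}
    (hf : ∀ a, Integrable (f a) ν) (c : ℝ) (m : ℕ) :
    SupLE (signed (Measure.pi fun _ : Fin m => ν))
      (fun a p => p.2 * (c * ∑ i, (f a (p.1 i) - ∫ x, f a x ∂ν)))
      (Measure.pi fun _ : Fin m => signed ν) (fun a z => ∑ i, (z i).2 * (2 * c * f a (z i).1)) := by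
  have hcf : ∀ a, Integrable (fun x => 2 * c * f a x) ν := fun a => (hf a).const_mul _
  have hZ : ∀ a, Integrable (fun p : β × ℝ => p.2 * (2 * c * f a p.1)) (signed ν) := fun a =>
    integrable_signed_smul (hcf a)
  have hZ' : ∀ a, Integrable (fun p : β × ℝ => p.2 * (2 * (-c * f a p.1))) (signed ν) :=
    fun a => integrable_signed_smul (((hf a).const_mul (-c)).const_mul 2)
  have hc : ∀ a (c : ℝ), Integrable (fun x => c * f a x - ∫ y, c * f a y ∂ν) ν := fun a c =>
    ((hf a).const_mul c).sub (integrable_const _)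
  have pos := (SupLE.signed_symm fun a => (hf a).const_mul c).pi (hc · c)
    (by simpa only [mul_assoc] using hZ) m
  -- For block sign `-1` the constant is `-c`; symmetry of the individual signs brings it back to
  -- the same dominating process as for `+1`.
  have neg := ((SupLE.signed_symm fun a => (hf a).const_mul (-c)).pi (hc · (-c)) hZ' m).trans
    (SupLE.pi (h := fun a (p : β × ℝ) => p.2 * (2 * c * f a p.1))
      (by
        convert SupLE.signed_neg hcf using 4
        ring) hZ' hZ m)
  have hS : ∀ a, Integrable (fun y : Fin m → β => c * ∑ i, (f a (y i) - ∫ x, f a x ∂ν))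
      (Measure.pi fun _ => ν) := fun a =>
    (integrable_pi_sum ((hf a).sub (integrable_const _))).const_mul c
  intro u
  rw [integral_signed_ciSup hS, integral_add (integrable_ciSup_const_add hS u)
    (integrable_ciSup_const_sub hS u)]
  have h₁ := pos u
  have h₂ := neg u
  simp only [integral_const_mul, ← mul_sub, ← Finset.mul_sum] at h₁ h₂
  simp only [neg_mul, ← sub_eq_add_neg, ← mul_assoc] at h₁ h₂ ⊢
  linarith

/-- The deviation of the mean over a block from the expectation. -/
noncomputable def blockDev (ν : Measure β) (f : β → ℝ) {m : ℕ} (y : Fin m → β) : ℝ :=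
  (m : ℝ)⁻¹ * ∑ i, (f (y i) - ∫ x, f x ∂ν)

/-- The Rademacher complexity of a finite family of functions for `ℓ * m` observations. -/
noncomputable def rademacher (ν : Measure β) (ℓ m : ℕ) (f : ι → β → ℝ) : ℝ :=
  ∫ z : Fin ℓ → Fin m → β × ℝ, (⨆ a, ∑ j, ∑ i, (z j i).2 * f a (z j i).1)
    ∂(Measure.pi fun _ => Measure.pi fun _ => signed ν)

theorem integrable_blockDev {ν : Measure β} [IsProbabilityMeasure ν] {f : β → ℝ}
    (hf : Integrable f ν) (m : ℕ) :
    Integrable (fun y : Fin m → β => blockDev ν f y) (Measure.pi fun _ => ν) :=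
  (integrable_pi_sum (hf.sub (integrable_const _))).const_mul _

theorem integral_abs_blockDev_le {ν : Measure β} [IsProbabilityMeasure ν] {f : β → ℝ}
    (hf : MemLp f 2 ν) {v : ℝ} (hv : 0 ≤ v) (hfv : ∫ x, f x ^ 2 ∂ν ≤ v ^ 2) (m : ℕ) :
    ∫ y : Fin m → β, |blockDev ν f y| ∂(Measure.pi fun _ => ν) ≤ v / √m := by
  have hi : Integrable f ν := hf.integrable (by norm_num)
  have hc : MemLp (fun x => f x - ∫ x, f x ∂ν) 2 ν := hf.sub (memLp_const _)
  have h0 : ∫ x, (f x - ∫ x, f x ∂ν) ∂ν = 0 := by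
    rw [integral_sub hi (integrable_const _)]; simp
  have h1 := integral_norm_pi_sum_le hc h0 m
  have h2 : ∫ x, ‖f x - ∫ x, f x ∂ν‖ ^ 2 ∂ν ≤ v ^ 2 := by
    simp only [Real.norm_eq_abs, sq_abs]
    rw [← variance_eq_integral hf.aemeasurable]
    exact (variance_le_expectation_sq hf.aestronglyMeasurable).trans hfv
  have h3 : √(∫ x, ‖f x - ∫ x, f x ∂ν‖ ^ 2 ∂ν) ≤ v := Real.sqrt_le_iff.2 ⟨hv, h2⟩
  simp only [blockDev, abs_mul, abs_inv, Nat.abs_cast, integral_const_mul]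
  calc _ ≤ (m : ℝ)⁻¹ * (√m * v) := by
        refine mul_le_mul_of_nonneg_left (h1.trans ?_) (by positivity)
        gcongr
    _ = v / √m := by
        rcases Nat.eq_zero_or_pos m with rfl | hm
        · simp
        · have : (0 : ℝ) < √m := Real.sqrt_pos.2 (by exact_mod_cast hm)
          field_simp
          rw [Real.sq_sqrt (by positivity)]

end Blocks

/-! ### Rademacher complexity of a class of minima. -/

section RademacherComplexity

variable {ι β : Type*} [MeasurableSpace β] [Finite ι] [Nonempty ι] {ν : Measure β}
  [IsProbabilityMeasure ν] {ℓ m : ℕ}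

theorem integrable_signed_sum {f : β → ℝ} (hf : Integrable f ν) (ℓ m : ℕ) :
    Integrable (fun z : Fin ℓ → Fin m → β × ℝ => ∑ j, ∑ i, (z j i).2 * f (z j i).1)
      (Measure.pi fun _ => Measure.pi fun _ => signed ν) :=
  integrable_pi_sum (integrable_pi_sum (g := fun p : β × ℝ => p.2 * f p.1)
    (integrable_signed_smul hf))

theorem rademacher_mono_of_supLE {f g : ι → β → ℝ} (hf : ∀ a, Integrable (f a) ν)
    (hg : ∀ a, Integrable (g a) ν)
    (H : SupLE (signed ν) (fun a p => p.2 * f a p.1) (signed ν) (fun a p => p.2 * g a p.1)) :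
    rademacher ν ℓ m f ≤ rademacher ν ℓ m g :=
  ((H.pi (fun a => integrable_signed_smul (hf a)) (fun a => integrable_signed_smul (hg a)) m).pi
    (fun a => integrable_pi_sum (g := fun p : β × ℝ => p.2 * f a p.1)
      (integrable_signed_smul (hf a)))
    (fun a => integrable_pi_sum (g := fun p : β × ℝ => p.2 * g a p.1)
      (integrable_signed_smul (hg a))) ℓ).integral_le

theorem rademacher_neg_le {f : ι → β → ℝ} (hf : ∀ a, Integrable (f a) ν) :
    rademacher ν ℓ m (fun a x => -f a x) ≤ rademacher ν ℓ m f :=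
  rademacher_mono_of_supLE (fun a => (hf a).neg) hf (SupLE.signed_neg hf)

theorem rademacher_abs_le {f : ι → β → ℝ} (hf : ∀ a, Integrable (f a) ν) :
    rademacher ν ℓ m (fun a x => |f a x|) ≤ rademacher ν ℓ m f :=
  rademacher_mono_of_supLE (fun a => (hf a).abs) hf
    (SupLE.signed_contraction (fun a => (hf a).abs) hf fun _ _ _ => abs_abs_sub_abs_le _ _)

theorem rademacher_add_le {f g : ι → β → ℝ} (hf : ∀ a, Integrable (f a) ν)
    (hg : ∀ a, Integrable (g a) ν) :
    rademacher ν ℓ m (fun a x => f a x + g a x) ≤ rademacher ν ℓ m f + rademacher ν ℓ m g := by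
  have h₁ := integrable_ciSup fun a => integrable_signed_sum (hf a) ℓ m
  have h₂ := integrable_ciSup fun a => integrable_signed_sum (hg a) ℓ m
  rw [rademacher, rademacher, rademacher, ← integral_add h₁ h₂]
  refine integral_mono
    (integrable_ciSup fun a => integrable_signed_sum ((hf a).add (hg a)) ℓ m) (h₁.add h₂) fun z => ?_
  simp only [mul_add, Finset.sum_add_distrib]
  exact ciSup_add_le _ _

omit [Finite ι] [Nonempty ι] [IsProbabilityMeasure ν] in
theorem rademacher_const_mul (f : ι → β → ℝ) {c : ℝ} (hc : 0 ≤ c) :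
    rademacher ν ℓ m (fun a x => c * f a x) = c * rademacher ν ℓ m f := by
  simp only [rademacher, ← integral_const_mul, Real.mul_iSup_of_nonneg hc, Finset.mul_sum,
    mul_left_comm]

/-- Write `min f g = (f + g - |f - g|) / 2`. Contraction removes the absolute value, so each of `f +
g` and `|f - g|` costs at most the sum of the two complexities. -/
theorem rademacher_min_le {f g : ι → β → ℝ} (hf : ∀ a, Integrable (f a) ν)
    (hg : ∀ a, Integrable (g a) ν) :
    rademacher ν ℓ m (fun a x => min (f a x) (g a x)) ≤
      rademacher ν ℓ m f + rademacher ν ℓ m g := by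
  have hn : ∀ a, Integrable (fun x => -g a x) ν := fun a => (hg a).neg
  have hs : ∀ a, Integrable (fun x => f a x + g a x) ν := fun a => (hf a).add (hg a)
  have hd : ∀ a, Integrable (fun x => f a x + -g a x) ν := fun a => (hf a).add (hn a)
  have e : (fun a x => min (f a x) (g a x)) =
      fun a x => 2⁻¹ * ((f a x + g a x) + -|f a x + -g a x|) := by
    funext a x
    rw [min_def, ← sub_eq_add_neg]
    split_ifs with h
    · rw [abs_of_nonpos (by linarith)]; ring
    · rw [abs_of_nonneg (by linarith)]; ring
  have h₁ := rademacher_add_le (ℓ := ℓ) (m := m) hs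
    (g := fun a x => -|f a x + -g a x|) fun a => (hd a).abs.neg
  have h₂ := rademacher_add_le (ℓ := ℓ) (m := m) hf hg
  have h₃ := rademacher_neg_le (ℓ := ℓ) (m := m) fun a => (hd a).abs
  have h₄ := rademacher_abs_le (ℓ := ℓ) (m := m) hd
  have h₅ := rademacher_add_le (ℓ := ℓ) (m := m) hf hn
  have h₆ := rademacher_neg_le (ℓ := ℓ) (m := m) hg
  rw [e, rademacher_const_mul _ (by norm_num)]
  linarith

omit [Finite ι] [Nonempty ι] [IsProbabilityMeasure ν] in
theorem integrable_inf' {κ : Type*} {S : Finset κ} (hS : S.Nonempty) {f : κ → β → ℝ}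
    (hf : ∀ j, Integrable (f j) ν) : Integrable (fun x => S.inf' hS fun j => f j x) ν := by
  induction hS using Finset.Nonempty.cons_induction with
  | singleton j => simpa using hf j
  | cons j s hj hs ih => simp only [Finset.inf'_cons hs]; exact (hf j).inf ih

/-- The Rademacher complexity of a class of minima is at most the sum of the complexities. -/
theorem rademacher_inf'_le {κ : Type*} {S : Finset κ} (hS : S.Nonempty) {f : κ → ι → β → ℝ}
    (hf : ∀ j a, Integrable (f j a) ν) :
    rademacher ν ℓ m (fun a x => S.inf' hS fun j => f j a x) ≤
      ∑ j ∈ S, rademacher ν ℓ m (f j) := by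
  induction hS using Finset.Nonempty.cons_induction with
  | singleton j => simp
  | cons j s hj hs ih =>
    simp only [Finset.inf'_cons hs, Finset.sum_cons]
    exact (rademacher_min_le (hf j) fun a => integrable_inf' hs fun j => hf j a).trans
      (by linarith)

end RademacherComplexity

/-! ### Uniform control of the number of deviating blocks. -/

section MedianOfMeansProcess

variable {ι β : Type*} [MeasurableSpace β] [Finite ι] [Nonempty ι] {ν : Measure β}
  [IsProbabilityMeasure ν] {ℓ m : ℕ}

theorem abs_min_one_abs_div_sub_le (r s t : ℝ) :
    |min 1 (|s| / r) - min 1 (|t| / r)| ≤ |r⁻¹ * s - r⁻¹ * t| := by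
  refine (abs_min_sub_min_le_max 1 _ 1 _).trans ?_
  rw [sub_self, abs_zero, max_eq_right (abs_nonneg _), ← sub_div, ← mul_sub, abs_div, abs_mul,
    abs_inv, inv_mul_eq_div]
  exact div_le_div_of_nonneg_right (abs_abs_sub_abs_le s t) (abs_nonneg r)

omit [Finite ι] [Nonempty ι] in
theorem integrable_truncated {f : β → ℝ} (hf : Integrable f ν) {r : ℝ} (m : ℕ) :
    Integrable (fun y : Fin m → β => min 1 (|blockDev ν f y| / r)) (Measure.pi fun _ => ν) :=
  (integrable_const (1 : ℝ)).inf ((integrable_blockDev hf m).abs.div_const r)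

/-- The expected number of deviating blocks, uniformly over a finite class. -/
theorem integral_ciSup_truncated_le {f : ι → β → ℝ} (hf : ∀ a, MemLp (f a) 2 ν) {v : ℝ}
    (hv : 0 ≤ v) (hfv : ∀ a, ∫ x, f a x ^ 2 ∂ν ≤ v ^ 2) {r : ℝ} (hr : 0 < r) (ℓ m : ℕ) :
    ∫ Y : Fin ℓ → Fin m → β, (⨆ a, ∑ j, min 1 (|blockDev ν (f a) (Y j)| / r))
        ∂(Measure.pi fun _ => Measure.pi fun _ => ν) ≤
      ℓ * (v / √m / r) + 4 * (r⁻¹ * (m : ℝ)⁻¹) * rademacher ν ℓ m f := by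
  have hi : ∀ a, Integrable (f a) ν := fun a => (hf a).integrable (by norm_num)
  set Q : Measure (Fin m → β) := Measure.pi fun _ => ν with hQ
  set ψ : ι → (Fin m → β) → ℝ := fun a y => min 1 (|blockDev ν (f a) y| / r) with hψ
  have hψi : ∀ a, Integrable (ψ a) Q := fun a => integrable_truncated (hi a) m
  have hq : ∀ a, ∫ y, ψ a y ∂Q ≤ v / √m / r := by
    intro a
    calc ∫ y, ψ a y ∂Q ≤ ∫ y, |blockDev ν (f a) y| / r ∂Q :=
          integral_mono (hψi a) ((integrable_blockDev (hi a) m).abs.div_const r)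
            fun y => min_le_right _ _
      _ ≤ v / √m / r := by
          rw [integral_div]
          exact div_le_div_of_nonneg_right (integral_abs_blockDev_le (hf a) hv (hfv a) m) hr.le
  have hdev : ∀ a, Integrable (fun y => r⁻¹ * (2 * blockDev ν (f a) y)) Q := fun a =>
    ((integrable_blockDev (hi a) m).const_mul 2).const_mul r⁻¹
  have h4 : ∀ a, Integrable (fun x => 4 * (r⁻¹ * (m : ℝ)⁻¹) * f a x) ν := fun a =>
    (hi a).const_mul _
  have s₁ := SupLE.signed_symm hψi
  have s₂ : SupLE (signed Q) (fun a p => p.2 * (2 * ψ a p.1)) (signed Q)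
      (fun a p => p.2 * (r⁻¹ * (2 * blockDev ν (f a) p.1))) := by
    refine SupLE.signed_contraction (fun a => (hψi a).const_mul 2) hdev fun a b x => ?_
    have := abs_min_one_abs_div_sub_le r (blockDev ν (f a) x) (blockDev ν (f b) x)
    calc _ = 2 * |ψ a x - ψ b x| := by rw [← mul_sub, abs_mul, abs_two]
      _ ≤ 2 * |r⁻¹ * blockDev ν (f a) x - r⁻¹ * blockDev ν (f b) x| := by gcongr
      _ = _ := by
        rw [← mul_sub, ← mul_sub, ← mul_sub, abs_mul, abs_mul, abs_mul, abs_two]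
        ring
  have s₃ : SupLE (signed Q) (fun a p => p.2 * (r⁻¹ * (2 * blockDev ν (f a) p.1)))
      (Measure.pi fun _ : Fin m => signed ν)
      (fun a z => ∑ i, (z i).2 * (4 * (r⁻¹ * (m : ℝ)⁻¹) * f a (z i).1)) := by
    -- The constant `4` collects a factor `2` from the symmetrization over blocks and another from
    -- the one inside them.
    convert SupLE.signed_block hi (2 * (r⁻¹ * (m : ℝ)⁻¹)) m using 3 with a p
    · rw [blockDev]; ring
    · refine Finset.sum_congr rfl fun i _ => ?_
      ring
  have s := (((s₁.trans s₂).trans s₃).pi (fun a => (hψi a).sub (integrable_const _))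
    (fun a => integrable_pi_sum (g := fun p : β × ℝ => p.2 * (4 * (r⁻¹ * (m : ℝ)⁻¹) * f a p.1))
      (integrable_signed_smul (h4 a))) ℓ).integral_le
  have hR : rademacher ν ℓ m (fun a x => 4 * (r⁻¹ * (m : ℝ)⁻¹) * f a x) =
      4 * (r⁻¹ * (m : ℝ)⁻¹) * rademacher ν ℓ m f := rademacher_const_mul f (by positivity)
  rw [rademacher] at hR
  rw [hR] at s
  have hD : Integrable (fun Y : Fin ℓ → Fin m → β => ⨆ a, ∑ j, (ψ a (Y j) - ∫ y, ψ a y ∂Q))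
      (Measure.pi fun _ => Q) :=
    integrable_ciSup fun a => integrable_pi_sum (g := fun y => ψ a y - ∫ y, ψ a y ∂Q)
      ((hψi a).sub (integrable_const _))
  calc _ ≤ ∫ Y : Fin ℓ → Fin m → β, (ℓ * (v / √m / r) +
        ⨆ a, ∑ j, (ψ a (Y j) - ∫ y, ψ a y ∂Q)) ∂(Measure.pi fun _ => Q) := by
        refine integral_mono (integrable_ciSup fun a => integrable_pi_sum (hψi a))
          ((integrable_const _).add hD) fun Y => ciSup_le fun a => ?_
        have := le_ciSup_of_finite (fun a => ∑ j, (ψ a (Y j) - ∫ y, ψ a y ∂Q)) a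
        simp only [Finset.sum_sub_distrib, Finset.sum_const, Finset.card_univ, Fintype.card_fin,
          nsmul_eq_mul] at this ⊢
        have := mul_le_mul_of_nonneg_left (hq a) (Nat.cast_nonneg (α := ℝ) ℓ)
        linarith
    _ ≤ _ := by
        rw [integral_add (integrable_const _) hD, integral_const, probReal_univ, one_smul]
        linarith

/-- The truncation dominates the indicator of a deviation and, unlike it, is Lipschitz, as
contraction demands. -/
theorem card_filter_lt_le_sum_truncated {r : ℝ} (hr : 0 < r) (t : Fin ℓ → ℝ) :
    ((Finset.univ.filter fun j => r < |t j|).card : ℝ) ≤ ∑ j, min 1 (|t j| / r) := by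
  rw [Finset.card_filter, Nat.cast_sum]
  refine Finset.sum_le_sum fun j _ => ?_
  split_ifs with h
  · rw [Nat.cast_one, min_eq_left ((one_le_div hr).2 h.le)]
  · rw [Nat.cast_zero]
    exact le_min zero_le_one (by positivity)

/-- With high probability, for all functions of the class, most block means are close to the
expectation. -/
theorem measure_exists_blockDev_gt_le {f : ι → β → ℝ} (hfm : ∀ a, Measurable (f a))
    (hf : ∀ a, MemLp (f a) 2 ν) {v : ℝ}
    (hv : 0 ≤ v) (hfv : ∀ a, ∫ x, f a x ^ 2 ∂ν ≤ v ^ 2) {r : ℝ} (hr : 0 < r)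
    (h : ℓ * (v / √m / r) + 4 * (r⁻¹ * (m : ℝ)⁻¹) * rademacher ν ℓ m f ≤ ℓ / 4) :
    (Measure.pi fun _ : Fin ℓ => Measure.pi fun _ : Fin m => ν)
      {Y | ∃ a, ℓ ≤ 2 * (Finset.univ.filter fun j => r < |blockDev ν (f a) (Y j)|).card} ≤
      ENNReal.ofReal (Real.exp (-(ℓ / 8))) := by
  have hmeas : ∀ a, Measurable fun y : Fin m → β => min 1 (|blockDev ν (f a) y| / r) := by
    intro a
    have := hfm a
    have h' : Measurable fun y : Fin m → β => blockDev ν (f a) y := by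
      unfold blockDev; fun_prop
    exact measurable_const.min (h'.abs.div_const r)
  -- The mean is at most `ℓ / 4`, so reaching half of the blocks takes an excess of `ℓ * s` with `s
  -- = 1 / 4`.
  have key := measure_ciSup_ge_le (ν := Measure.pi fun _ : Fin m => ν) hmeas
    (fun a y => ⟨le_min zero_le_one (by positivity), min_le_left _ _⟩) ℓ (s := 1 / 4)
    (T := ℓ / 2) (by norm_num)
    (by linarith [integral_ciSup_truncated_le hf hv hfv hr ℓ m])
  rw [← ENNReal.ofReal_toReal (measure_ne_top _ {Y | ∃ a, _}), ← measureReal_def]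
  refine ENNReal.ofReal_le_ofReal ((measureReal_mono ?_).trans (key.trans (le_of_eq ?_)))
  · rintro Y ⟨a, ha⟩
    have h₁ := card_filter_lt_le_sum_truncated hr fun j => blockDev ν (f a) (Y j)
    have h₂ := le_ciSup_of_finite (fun a => ∑ j, min 1 (|blockDev ν (f a) (Y j)| / r)) a
    have h₃ : (ℓ : ℝ) ≤ 2 * (Finset.univ.filter fun j => r < |blockDev ν (f a) (Y j)|).card := by
      exact_mod_cast ha
    simp only [Set.mem_ofPred_eq]
    linarith
  · congr 1
    ring

end MedianOfMeansProcess

/-! ### The median as an order statistic. -/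

section MedianProperties

variable {ℓ : ℕ} [NeZero ℓ]

theorem median_le_iff (y : Fin ℓ → ℝ) (c : ℝ) :
    median y ≤ c ↔ (ℓ - 1) / 2 < (Finset.univ.filter fun j => y j ≤ c).card := by
  have hp : (ℓ - 1) / 2 < ℓ :=
    lt_of_le_of_lt (Nat.div_le_self _ _) (Nat.sub_lt (NeZero.pos ℓ) Nat.one_pos)
  have hmono := Tuple.monotone_sort y
  have hcard : (Finset.univ.filter fun j => y j ≤ c).card =
      (Finset.univ.filter fun i => y (Tuple.sort y i) ≤ c).card :=
    (Finset.card_bijective (Tuple.sort y) (Tuple.sort y).bijective fun i => by simp).symm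
  rw [hcard]
  constructor
  · intro h
    have hsub : Finset.Iic (⟨(ℓ - 1) / 2, hp⟩ : Fin ℓ) ⊆
        Finset.univ.filter fun i => y (Tuple.sort y i) ≤ c := fun i hi => by
      simpa using (hmono (Finset.mem_Iic.1 hi)).trans h
    have := Finset.card_le_card hsub
    rw [Fin.card_Iic] at this
    exact this
  · intro h
    by_contra hlt
    push Not at hlt
    have hsub : (Finset.univ.filter fun i => y (Tuple.sort y i) ≤ c) ⊆
        Finset.Iio (⟨(ℓ - 1) / 2, hp⟩ : Fin ℓ) := fun i hi => by
      rw [Finset.mem_Iio]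
      by_contra hle
      push Not at hle
      exact absurd ((hlt.trans_le (hmono hle))) (not_lt.2 (by simpa using hi))
    have := Finset.card_le_card hsub
    rw [Fin.card_Iio] at this
    exact absurd this (not_le.2 h)

theorem median_le_add {y z : Fin ℓ → ℝ} {c : ℝ} (h : ∀ j, y j ≤ z j + c) :
    median y ≤ median z + c := by
  rw [median_le_iff]
  refine ((median_le_iff z _).1 le_rfl).trans_le (Finset.card_le_card fun j hj => ?_)
  simp only [Finset.mem_filter, Finset.mem_univ, true_and] at hj ⊢
  linarith [h j]

theorem abs_median_sub_le {y : Fin ℓ → ℝ} {c r : ℝ}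
    (h : 2 * (Finset.univ.filter fun j => r < |y j - c|).card < ℓ) : |median y - c| ≤ r := by
  rw [abs_le]
  constructor
  · by_contra hlt
    push Not at hlt
    have h₁ := (median_le_iff y _).1 le_rfl
    have h₂ : (Finset.univ.filter fun j => y j ≤ median y).card ≤
        (Finset.univ.filter fun j => r < |y j - c|).card :=
      Finset.card_le_card fun j hj => by
        simp only [Finset.mem_filter, Finset.mem_univ, true_and] at hj ⊢
        exact lt_abs.2 (Or.inr (by linarith))
    omega
  · suffices median y ≤ c + r by linarith
    rw [median_le_iff]
    have h₁ := Finset.card_filter_add_card_filter_not (s := Finset.univ) fun j => y j ≤ c + r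
    have h₂ : (Finset.univ.filter fun j => ¬ y j ≤ c + r).card ≤
        (Finset.univ.filter fun j => r < |y j - c|).card :=
      Finset.card_le_card fun j hj => by
        simp only [Finset.mem_filter, Finset.mem_univ, true_and] at hj ⊢
        exact lt_abs.2 (Or.inl (by linarith))
    rw [Finset.card_univ, Fintype.card_fin] at h₁
    omega

/-- The sorting permutation jumps, but `median_le_add` makes the median 1-Lipschitz for the supremum
distance. -/
theorem continuous_median : Continuous (median : (Fin ℓ → ℝ) → ℝ) := by
  refine LipschitzWith.continuous (K := 1) (LipschitzWith.of_dist_le_mul fun y z => ?_)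
  have h : ∀ y z : Fin ℓ → ℝ, median y ≤ median z + dist y z := fun y z =>
    median_le_add fun j => by
      have := (le_abs_self _).trans (dist_le_pi_dist y z j)
      linarith
  rw [NNReal.coe_one, one_mul, Real.dist_eq, abs_le]
  constructor
  · linarith [h z y, dist_comm z y]
  · linarith [h y z]

end MedianProperties

/-! ### Losses of tuples of centres and existence of minimizers. -/

section Losses

variable {E : Type*} [NormedAddCommGroup E] [InnerProductSpace ℝ E]

/-- The loss contributed by a single centre. -/
noncomputable def centreLoss (a x : E) : ℝ := -2 * inner ℝ x a + ‖a‖ ^ 2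

/-- The loss of a quantizer that is given by an enumeration of its centres. -/
noncomputable def tupleLoss {k : ℕ} (a : Fin k → E) (x : E) : ℝ := ⨅ j, centreLoss (a j) x

/-- Repetitions pad a smaller quantizer to a `k`-tuple. Tuples, unlike finite sets, come with the
topology needed for compactness and density. -/
theorem exists_tuple_of_mem_boundedQuantizers {k : ℕ} {M : ℝ} {A : Finset E}
    (hA : A ∈ boundedQuantizers E k M) :
    ∃ a : Fin k → E, (∀ j, ‖a j‖ ≤ M) ∧ loss A = tupleLoss a := by
  obtain ⟨⟨hne, hk⟩, hM⟩ := hA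
  have : Nonempty A := hne.to_subtype
  obtain ⟨e, he⟩ : ∃ e : Fin k → A, Function.Surjective e := by
    have hf : Nonempty (A ↪ Fin k) :=
      Function.Embedding.nonempty_of_card_le (by simpa using hk)
    exact ⟨Function.invFun hf.some, Function.invFun_surjective hf.some.injective⟩
  refine ⟨fun j => e j, fun j => hM _ (e j).2, funext fun x => ?_⟩
  exact (he.iInf_comp fun a : A => -2 * inner ℝ x (a : E) + ‖(a : E)‖ ^ 2).symm

theorem exists_mem_boundedQuantizers_of_tuple {k : ℕ} [NeZero k] {M : ℝ} (a : Fin k → E)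
    (ha : ∀ j, ‖a j‖ ≤ M) : ∃ A ∈ boundedQuantizers E k M, loss A = tupleLoss a := by
  classical
  refine ⟨Finset.univ.image a, ⟨⟨Finset.univ_nonempty.image a, ?_⟩, by simpa using ha⟩,
    funext fun x => ?_⟩
  · simpa using Finset.card_image_le (s := Finset.univ) (f := a)
  · let e : Fin k → (Finset.univ.image a : Finset E) := fun j => ⟨a j, by simp⟩
    have he : Function.Surjective e := by
      rintro ⟨b, hb⟩
      obtain ⟨j, -, rfl⟩ := Finset.mem_image.1 hb
      exact ⟨j, rfl⟩
    exact (he.iInf_comp fun a => -2 * inner ℝ x (a : E) + ‖(a : E)‖ ^ 2).symm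

theorem tupleLoss_eq_inf' {k : ℕ} [NeZero k] (a : Fin k → E) (x : E) :
    tupleLoss a x = Finset.univ.inf' Finset.univ_nonempty fun j => centreLoss (a j) x :=
  (Finset.inf'_univ_eq_ciInf _).symm

theorem continuous_centreLoss : Continuous fun p : E × E => centreLoss p.1 p.2 := by
  unfold centreLoss
  fun_prop

theorem continuous_tupleLoss {k : ℕ} [NeZero k] :
    Continuous fun p : (Fin k → E) × E => tupleLoss p.1 p.2 := by
  simp only [tupleLoss_eq_inf']
  refine Continuous.finset_inf'_apply Finset.univ_nonempty fun j _ => ?_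
  have : Continuous fun p : (Fin k → E) × E => (p.1 j, p.2) := by fun_prop
  exact continuous_centreLoss.comp this

theorem abs_centreLoss_le {a : E} {M : ℝ} (ha : ‖a‖ ≤ M) (x : E) :
    |centreLoss a x| ≤ 2 * M * ‖x‖ + M ^ 2 := by
  have h₁ := abs_real_inner_le_norm x a
  have h₂ : ‖x‖ * ‖a‖ ≤ M * ‖x‖ := by
    rw [mul_comm]; exact mul_le_mul_of_nonneg_right ha (norm_nonneg x)
  have h₃ : ‖a‖ ^ 2 ≤ M ^ 2 := by gcongr
  have := abs_le.1 h₁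
  rw [centreLoss, abs_le]
  constructor <;> nlinarith [norm_nonneg a, sq_nonneg ‖a‖]

theorem abs_tupleLoss_le {k : ℕ} [NeZero k] {a : Fin k → E} {M : ℝ} (ha : ∀ j, ‖a j‖ ≤ M)
    (x : E) : |tupleLoss a x| ≤ 2 * M * ‖x‖ + M ^ 2 := by
  obtain ⟨j, hj⟩ := exists_eq_ciInf_of_finite (f := fun j => centreLoss (a j) x)
  rw [tupleLoss, ← hj]
  exact abs_centreLoss_le (ha j) x

theorem iInf_norm_sub_sq {A : Finset E} (hA : A.Nonempty) (x : E) :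
    ⨅ a : A, ‖x - (a : E)‖ ^ 2 = ‖x‖ ^ 2 + loss A x := by
  have : Nonempty A := hA.to_subtype
  have := (OrderIso.addLeft (‖x‖ ^ 2)).map_ciInf
    (Set.finite_range fun a : A => -2 * inner ℝ x (a : E) + ‖(a : E)‖ ^ 2).bddBelow
  simp only [OrderIso.addLeft_apply] at this
  rw [loss, this]
  congr 1
  ext a
  rw [norm_sub_sq_real]
  ring

/-- Every sample has a minimizer of the median of means of the loss. -/
theorem exists_isMOMMinimizer {k N : ℕ} (hk : 1 ≤ k) {M : ℝ} (hM : 0 ≤ M) (δ : ℝ)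
    (x : Fin N → E) : ∃ A : Finset E, IsMOMMinimizer k M δ x A := by
  have : NeZero k := ⟨by omega⟩
  -- Projection to this span keeps the inner products with the sample and does not increase norms,
  -- so centres in it suffice; being finite-dimensional, it has compact balls.
  set V : Submodule ℝ E := Submodule.span ℝ (Set.range x) with hV
  have : FiniteDimensional ℝ V := FiniteDimensional.span_of_finite ℝ (Set.finite_range x)
  let K : Set (Fin k → V) := Set.pi Set.univ fun _ => Metric.closedBall 0 M
  have hK : IsCompact K := isCompact_univ_pi fun _ => isCompact_closedBall 0 M
  let F : (Fin k → V) → ℝ := fun b =>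
    medianOfMeans (numBlocks δ) x (tupleLoss fun j => (b j : E))
  have hF : Continuous F := by
    refine continuous_median.comp (continuous_pi fun j => continuous_const.mul
      (continuous_finsetSum _ fun i _ => ?_))
    exact continuous_tupleLoss.comp
      ((continuous_pi fun j => continuous_subtype_val.comp (continuous_apply j)).prodMk
        continuous_const)
  obtain ⟨b, hb, hmin⟩ := hK.exists_isMinOn (f := F) ⟨0, fun j _ => by simpa using hM⟩
    hF.continuousOn
  obtain ⟨A, hA, hAloss⟩ := exists_mem_boundedQuantizers_of_tuple (M := M) (fun j => (b j : E))
    fun j => by simpa using hb j (Set.mem_univ j)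
  refine ⟨A, hA, fun B hB => ?_⟩
  obtain ⟨a, ha, hBloss⟩ := exists_tuple_of_mem_boundedQuantizers hB
  have h₁ : F b ≤ F fun j => V.orthogonalProjectionOnto (a j) := hmin fun j _ => by
    simpa using (V.norm_orthogonalProjectionOnto_apply_le (a j)).trans (ha j)
  have h₂ : F (fun j => V.orthogonalProjectionOnto (a j)) ≤
      medianOfMeans (numBlocks δ) x (tupleLoss a) := by
    have := median_le_add (c := 0)
      (y := fun j : Fin (numBlocks δ) => ((N / numBlocks δ : ℕ) : ℝ)⁻¹ *
        ∑ i ∈ block (N / numBlocks δ) j,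
          tupleLoss (fun j => (V.orthogonalProjectionOnto (a j) : E)) (x i))
      (z := fun j : Fin (numBlocks δ) => ((N / numBlocks δ : ℕ) : ℝ)⁻¹ *
        ∑ i ∈ block (N / numBlocks δ) j, tupleLoss a (x i)) fun j => by
        rw [add_zero]
        refine mul_le_mul_of_nonneg_left (Finset.sum_le_sum fun i _ => ?_) (by positivity)
        refine ciInf_mono (Set.finite_range _).bddBelow fun j => ?_
        have hx : x i ∈ V := Submodule.subset_span ⟨i, rfl⟩
        have hin : inner ℝ (x i) (V.orthogonalProjectionOnto (a j) : E) = inner ℝ (x i) (a j) :=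
          V.inner_orthogonalProjectionOnto_eq_of_mem_left ⟨x i, hx⟩ (a j)
        have hn : ‖(V.orthogonalProjectionOnto (a j) : E)‖ ≤ ‖a j‖ :=
          V.norm_orthogonalProjectionOnto_apply_le (a j)
        rw [centreLoss, centreLoss, hin]
        gcongr
    rwa [add_zero] at this
  change medianOfMeans _ x (loss A) ≤ medianOfMeans _ x (loss B)
  rw [hAloss, hBloss]
  exact h₁.trans h₂

end Losses

/-! ### Second moments of randomly signed sums. -/

section SignedSums

variable {β H : Type*} [MeasurableSpace β] [NormedAddCommGroup H] [InnerProductSpace ℝ H]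
  [CompleteSpace H] {ν : Measure β} [IsProbabilityMeasure ν]

omit [CompleteSpace H] in
theorem memLp_signed_smul {g : β → H} (hg : MemLp g 2 ν) :
    MemLp (fun p : β × ℝ => p.2 • g p.1) 2 (signed ν) := by
  have hi := integrable_signed_smul (hg.integrable (q := 2) (by norm_num))
  rw [memLp_two_iff_integrable_sq_norm hi.aestronglyMeasurable]
  have h2 := hg.integrable_norm_pow (p := 2) (by norm_num)
  exact integrable_signed (by simpa using h2) (by simpa using h2)

omit [CompleteSpace H] [IsProbabilityMeasure ν] in
theorem integral_norm_sq_signed_smul {g : β → H} (hg : MemLp g 2 ν) :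
    ∫ p, ‖p.2 • g p.1‖ ^ 2 ∂(signed ν) = ∫ x, ‖g x‖ ^ 2 ∂ν := by
  have h2 := hg.integrable_norm_pow (p := 2) (by norm_num)
  rw [integral_signed (by simpa using h2) (by simpa using h2)]
  simp only [one_smul, neg_smul, norm_neg, smul_eq_mul]
  ring

theorem integral_norm_signed_sum_le {g : β → H} (hg : MemLp g 2 ν) (ℓ m : ℕ) :
    ∫ z : Fin ℓ → Fin m → β × ℝ, ‖∑ j, ∑ i, (z j i).2 • g (z j i).1‖
      ∂(Measure.pi fun _ => Measure.pi fun _ => signed ν) ≤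
      √ℓ * √m * √(∫ x, ‖g x‖ ^ 2 ∂ν) := by
  have hs := memLp_signed_smul hg
  have hi := integrable_signed_smul (hg.integrable (q := 2) (by norm_num))
  have h0 := integral_signed_smul (hg.integrable (q := 2) (by norm_num))
  have := integral_norm_pi_sum_le (memLp_pi_sum hs m)
    (by rw [integral_pi_sum hi, h0, smul_zero]) ℓ
  rwa [integral_norm_sq_pi_sum hs h0, integral_norm_sq_signed_smul hg,
    Real.sqrt_mul (by positivity), ← mul_assoc] at this

end SignedSums

/-! ### Moments and Rademacher complexity of the losses. -/

section LossMoments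

variable {E : Type*} [NormedAddCommGroup E] [InnerProductSpace ℝ E]
  [SecondCountableTopology E] [MeasurableSpace E] [BorelSpace E] {P : Measure E}
  [IsProbabilityMeasure P] {k : ℕ} {M : ℝ}

omit [InnerProductSpace ℝ E] [IsProbabilityMeasure P] in
theorem memLp_id_of_integrable_sq (hP : Integrable (fun x => ‖x‖ ^ 2) P) :
    MemLp (fun x : E => x) 2 P :=
  (memLp_two_iff_integrable_sq_norm measurable_id.aestronglyMeasurable).2 hP

omit [InnerProductSpace ℝ E] in
theorem integral_norm_le_sqrt_second_moment (hP : Integrable (fun x => ‖x‖ ^ 2) P) :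
    ∫ x, ‖x‖ ∂P ≤ √(∫ x, ‖x‖ ^ 2 ∂P) :=
  integral_norm_le_sqrt (memLp_id_of_integrable_sq hP)

omit [InnerProductSpace ℝ E] in
theorem memLp_lossBound (hP : Integrable (fun x => ‖x‖ ^ 2) P) (M : ℝ) :
    MemLp (fun x : E => 2 * M * ‖x‖ + M ^ 2) 2 P :=
  ((memLp_id_of_integrable_sq hP).norm.const_mul _).add (memLp_const _)

omit [SecondCountableTopology E] in
theorem measurable_tupleLoss [NeZero k] (a : Fin k → E) : Measurable (tupleLoss a) :=
  (continuous_tupleLoss.comp (Continuous.prodMk_right a)).measurable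

theorem memLp_tupleLoss [NeZero k] (hP : Integrable (fun x => ‖x‖ ^ 2) P) {a : Fin k → E}
    (ha : ∀ j, ‖a j‖ ≤ M) : MemLp (tupleLoss a) 2 P :=
  (memLp_lossBound hP M).mono (measurable_tupleLoss a).aestronglyMeasurable
    (Filter.Eventually.of_forall fun x =>
      (abs_tupleLoss_le ha x).trans (le_abs_self _))

theorem memLp_centreLoss (hP : Integrable (fun x => ‖x‖ ^ 2) P) (a : E) :
    MemLp (centreLoss a) 2 P :=
  (memLp_lossBound hP ‖a‖).mono
    (continuous_centreLoss.comp (Continuous.prodMk_right a)).measurable.aestronglyMeasurable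
    (Filter.Eventually.of_forall fun x => (abs_centreLoss_le le_rfl x).trans (le_abs_self _))

theorem integral_tupleLoss_sq_le [NeZero k] (hP : Integrable (fun x => ‖x‖ ^ 2) P)
    {a : Fin k → E} (hM : 0 ≤ M) (ha : ∀ j, ‖a j‖ ≤ M) :
    ∫ x, tupleLoss a x ^ 2 ∂P ≤ (2 * M * √(∫ x, ‖x‖ ^ 2 ∂P) + M ^ 2) ^ 2 := by
  have hn : Integrable (fun x : E => ‖x‖) P :=
    (memLp_id_of_integrable_sq hP).norm.integrable (by norm_num)
  have hσ : √(∫ x, ‖x‖ ^ 2 ∂P) ^ 2 = ∫ x, ‖x‖ ^ 2 ∂P :=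
    Real.sq_sqrt (integral_nonneg fun x => by positivity)
  have h₁ : Integrable (fun x : E => 4 * M ^ 2 * ‖x‖ ^ 2) P := hP.const_mul _
  have h₂ : Integrable (fun x : E => 4 * M ^ 3 * ‖x‖) P := hn.const_mul _
  have h₃ : Integrable (fun x : E => 4 * M ^ 2 * ‖x‖ ^ 2 + 4 * M ^ 3 * ‖x‖) P := h₁.add h₂
  calc ∫ x, tupleLoss a x ^ 2 ∂P
      ≤ ∫ x, (4 * M ^ 2 * ‖x‖ ^ 2 + 4 * M ^ 3 * ‖x‖ + M ^ 4) ∂P := by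
        refine integral_mono (memLp_tupleLoss hP ha).integrable_sq
          (h₃.add (integrable_const _)) fun x => ?_
        have := sq_le_sq' (abs_le.1 (abs_tupleLoss_le ha x)).1 (abs_le.1 (abs_tupleLoss_le ha x)).2
        dsimp only
        linarith
    _ = 4 * M ^ 2 * (∫ x, ‖x‖ ^ 2 ∂P) + 4 * M ^ 3 * (∫ x, ‖x‖ ∂P) + M ^ 4 := by
        rw [integral_add h₃ (integrable_const _), integral_add h₁ h₂, integral_const_mul,
          integral_const_mul, integral_const, probReal_univ, one_smul]
    _ ≤ 4 * M ^ 2 * (∫ x, ‖x‖ ^ 2 ∂P) + 4 * M ^ 3 * √(∫ x, ‖x‖ ^ 2 ∂P) + M ^ 4 := by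
        gcongr
        exact integral_norm_le_sqrt_second_moment hP
    _ = _ := by
        rw [← hσ, Real.sqrt_sq (Real.sqrt_nonneg _)]
        ring

theorem abs_integral_tupleLoss_le [NeZero k] (hP : Integrable (fun x => ‖x‖ ^ 2) P)
    {a : Fin k → E} (hM : 0 ≤ M) (ha : ∀ j, ‖a j‖ ≤ M) :
    |∫ x, tupleLoss a x ∂P| ≤ 2 * M * √(∫ x, ‖x‖ ^ 2 ∂P) + M ^ 2 := by
  refine abs_le_of_sq_le_sq ?_ (by positivity)
  refine le_trans ?_ (integral_tupleLoss_sq_le hP hM ha)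
  have := variance_nonneg (tupleLoss a) P
  rw [variance_eq_sub (memLp_tupleLoss hP ha)] at this
  simpa using this

variable [CompleteSpace E] {ι : Type*} [Finite ι] [Nonempty ι]

/-- The signed sum is linear in `b s` and `‖b s‖ ^ 2`. Cauchy–Schwarz bounds the supremum by norms
of two signed sums free of `s`, so neither the size of the class nor the dimension enters. -/
theorem rademacher_centreLoss_le (hP : Integrable (fun x => ‖x‖ ^ 2) P) (hM : 0 ≤ M)
    {b : ι → E} (hb : ∀ s, ‖b s‖ ≤ M) (ℓ m : ℕ) :
    rademacher P ℓ m (fun s => centreLoss (b s)) ≤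
      (2 * M * √(∫ x, ‖x‖ ^ 2 ∂P) + M ^ 2) * (√ℓ * √m) := by
  have hid := memLp_id_of_integrable_sq hP
  have hone : MemLp (fun _ : E => (1 : ℝ)) 2 P := memLp_const 1
  have h₁ := integral_norm_signed_sum_le hid ℓ m
  have h₂ := integral_norm_signed_sum_le hone ℓ m
  have i₁ : Integrable (fun z : Fin ℓ → Fin m → E × ℝ => ‖∑ j, ∑ i, (z j i).2 • (z j i).1‖)
      (Measure.pi fun _ => Measure.pi fun _ => signed P) :=
    ((memLp_pi_sum (memLp_pi_sum (memLp_signed_smul hid) m) ℓ).integrable (by norm_num)).norm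
  have i₂ : Integrable (fun z : Fin ℓ → Fin m → E × ℝ => ‖∑ j, ∑ i, (z j i).2 • (1 : ℝ)‖)
      (Measure.pi fun _ => Measure.pi fun _ => signed P) :=
    ((memLp_pi_sum (memLp_pi_sum (memLp_signed_smul hone) m) ℓ).integrable (by norm_num)).norm
  calc rademacher P ℓ m (fun s => centreLoss (b s))
      ≤ ∫ z : Fin ℓ → Fin m → E × ℝ, (2 * M * ‖∑ j, ∑ i, (z j i).2 • (z j i).1‖ +
          M ^ 2 * ‖∑ j, ∑ i, (z j i).2 • (1 : ℝ)‖)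
          ∂(Measure.pi fun _ => Measure.pi fun _ => signed P) := by
        refine integral_mono (integrable_ciSup fun s => integrable_signed_sum
          ((memLp_centreLoss hP (b s)).integrable (by norm_num)) ℓ m)
          ((i₁.const_mul _).add (i₂.const_mul _)) fun z => ciSup_le fun s => ?_
        have e : ∑ j, ∑ i, (z j i).2 * centreLoss (b s) (z j i).1 =
            -2 * inner ℝ (∑ j, ∑ i, (z j i).2 • (z j i).1) (b s) +
              ‖b s‖ ^ 2 * ∑ j, ∑ i, (z j i).2 • (1 : ℝ) := by
          simp only [sum_inner, real_inner_smul_left, Finset.mul_sum, ← Finset.sum_add_distrib]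
          refine Finset.sum_congr rfl fun j _ => Finset.sum_congr rfl fun i _ => ?_
          rw [centreLoss, smul_eq_mul]
          ring
        rw [e]
        have c₁ := abs_le.1
          (abs_real_inner_le_norm (∑ j, ∑ i, (z j i).2 • (z j i).1) (b s))
        have c₂ : ‖∑ j, ∑ i, (z j i).2 • (z j i).1‖ * ‖b s‖ ≤
            ‖∑ j, ∑ i, (z j i).2 • (z j i).1‖ * M := by gcongr; exact hb s
        have c₃ : ‖b s‖ ^ 2 * ∑ j, ∑ i, (z j i).2 • (1 : ℝ) ≤
            M ^ 2 * ‖∑ j, ∑ i, (z j i).2 • (1 : ℝ)‖ := by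
          refine (mul_le_mul_of_nonneg_left (le_abs_self _) (by positivity)).trans ?_
          rw [Real.norm_eq_abs]
          gcongr
          exact hb s
        linarith [c₁.1]
    _ ≤ 2 * M * (√ℓ * √m * √(∫ x, ‖x‖ ^ 2 ∂P)) +
          M ^ 2 * (√ℓ * √m * √(∫ x : E, ‖(1 : ℝ)‖ ^ 2 ∂P)) := by
        rw [integral_add (i₁.const_mul _) (i₂.const_mul _), integral_const_mul,
          integral_const_mul]
        gcongr
    _ = _ := by
        simp
        ring

theorem rademacher_tupleLoss_le [NeZero k] (hP : Integrable (fun x => ‖x‖ ^ 2) P) (hM : 0 ≤ M)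
    {a : ι → Fin k → E} (ha : ∀ s j, ‖a s j‖ ≤ M) (ℓ m : ℕ) :
    rademacher P ℓ m (fun s => tupleLoss (a s)) ≤
      k * ((2 * M * √(∫ x, ‖x‖ ^ 2 ∂P) + M ^ 2) * (√ℓ * √m)) := by
  have := rademacher_inf'_le (ν := P) (ℓ := ℓ) (m := m) (S := (Finset.univ : Finset (Fin k)))
    Finset.univ_nonempty (f := fun j s => centreLoss (a s j))
    fun j s => (memLp_centreLoss hP (a s j)).integrable (by norm_num)
  simp only [← tupleLoss_eq_inf'] at this
  refine this.trans ((Finset.sum_le_sum fun j _ =>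
    rademacher_centreLoss_le hP hM (fun s => ha s j) ℓ m).trans (le_of_eq ?_))
  simp

/-- The accuracy of the block means, for `ℓ` blocks of length `m` and losses of size `V`. -/
noncomputable def accuracy (V : ℝ) (k ℓ m : ℕ) : ℝ := 8 * V / √m + 32 * k * V / (√ℓ * √m)

theorem measure_exists_finite_tuple_le [NeZero k] (hP : Integrable (fun x => ‖x‖ ^ 2) P)
    (hM : 0 < M) {a : ι → Fin k → E} (ha : ∀ s j, ‖a s j‖ ≤ M) {ℓ m : ℕ} (hℓ : 0 < ℓ)
    (hm : 0 < m) :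
    (Measure.pi fun _ : Fin ℓ => Measure.pi fun _ : Fin m => P)
      {Y | ∃ s, ℓ ≤ 2 * (Finset.univ.filter fun j =>
        accuracy (2 * M * √(∫ x, ‖x‖ ^ 2 ∂P) + M ^ 2) k ℓ m <
          |blockDev P (tupleLoss (a s)) (Y j)|).card} ≤
      ENNReal.ofReal (Real.exp (-(ℓ / 8))) := by
  have hR := rademacher_tupleLoss_le hP hM.le ha ℓ m
  have hV : 0 < 2 * M * √(∫ x, ‖x‖ ^ 2 ∂P) + M ^ 2 := by positivity
  have hv2 := fun s => integral_tupleLoss_sq_le hP hM.le (ha s)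
  set V := 2 * M * √(∫ x, ‖x‖ ^ 2 ∂P) + M ^ 2
  have hk : (0 : ℝ) < k := by exact_mod_cast NeZero.pos k
  have sℓ : 0 < √(ℓ : ℝ) := Real.sqrt_pos.2 (by exact_mod_cast hℓ)
  have sm : 0 < √(m : ℝ) := Real.sqrt_pos.2 (by exact_mod_cast hm)
  have eℓ : (ℓ : ℝ) = √ℓ * √ℓ := (Real.mul_self_sqrt (by positivity)).symm
  have em : (m : ℝ) = √m * √m := (Real.mul_self_sqrt (by positivity)).symm
  have hr : 0 < accuracy V k ℓ m := by unfold accuracy; positivity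
  refine measure_exists_blockDev_gt_le (fun s => measurable_tupleLoss (a s))
    (fun s => memLp_tupleLoss hP (ha s)) hV.le hv2 hr ?_
  set r := accuracy V k ℓ m with hrdef
  have r₁ : 8 * V / √m ≤ r := by
    rw [hrdef, accuracy]; exact le_add_of_nonneg_right (by positivity)
  have r₂ : 32 * k * V / (√ℓ * √m) ≤ r := by
    rw [hrdef, accuracy]; exact le_add_of_nonneg_left (by positivity)
  -- The allowance `ℓ / 4` is shared equally by mean deviation and complexity; this fixes the
  -- constants `8` and `32` in `accuracy`.
  have t₁ : ℓ * (V / √m / r) ≤ ℓ / 8 := by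
    have : V / √m / r ≤ 1 / 8 := by
      rw [div_le_iff₀ hr]
      calc V / √m = 1 / 8 * (8 * V / √m) := by ring
        _ ≤ _ := by gcongr
    calc _ ≤ (ℓ : ℝ) * (1 / 8) := by gcongr
      _ = _ := by ring
  have t₂ : 4 * (r⁻¹ * (m : ℝ)⁻¹) * rademacher P ℓ m (fun s => tupleLoss (a s)) ≤ ℓ / 8 := by
    calc _ ≤ 4 * (r⁻¹ * (m : ℝ)⁻¹) * (k * (V * (√ℓ * √m))) := by gcongr
      _ = (ℓ / 8) * ((32 * k * V / (√ℓ * √m)) / r) := by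
          rw [eℓ, em]
          simp only [Real.sqrt_mul_self sℓ.le, Real.sqrt_mul_self sm.le]
          field_simp
          ring
      _ ≤ (ℓ / 8) * 1 := by
          gcongr
          exact (div_le_one hr).2 r₂
      _ = _ := by ring
  linarith

end LossMoments

/-! ### From finite classes to all bounded tuples. -/

section UniformDeviation

variable {E : Type*} [NormedAddCommGroup E] [InnerProductSpace ℝ E]
  [SecondCountableTopology E] [MeasurableSpace E] [BorelSpace E] {P : Measure E}
  [IsProbabilityMeasure P] {k : ℕ} [NeZero k] {M : ℝ}

theorem continuous_integral_tupleLoss (hP : Integrable (fun x => ‖x‖ ^ 2) P) (M : ℝ) :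
    Continuous fun s : Fin k → Metric.closedBall (0 : E) M =>
      ∫ x, tupleLoss (fun j => (s j : E)) x ∂P := by
  refine continuous_of_dominated (bound := fun x => 2 * M * ‖x‖ + M ^ 2)
    (fun s => (measurable_tupleLoss _).aestronglyMeasurable)
    (fun s => Filter.Eventually.of_forall fun x =>
      abs_tupleLoss_le (fun j => mem_closedBall_zero_iff.1 (s j).2) x)
    ((memLp_lossBound hP M).integrable (by norm_num))
    (Filter.Eventually.of_forall fun x => continuous_tupleLoss.comp (Continuous.prodMk_left x |>.comp
      (continuous_pi fun j => continuous_subtype_val.comp (continuous_apply j))))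

theorem continuous_blockDev_tupleLoss (hP : Integrable (fun x => ‖x‖ ^ 2) P) (M : ℝ) {m : ℕ}
    (y : Fin m → E) :
    Continuous fun s : Fin k → Metric.closedBall (0 : E) M =>
      blockDev P (tupleLoss fun j => (s j : E)) y :=
  continuous_const.mul (continuous_finsetSum _ fun i _ =>
    (continuous_tupleLoss.comp (Continuous.prodMk_left (y i) |>.comp
      (continuous_pi fun j => continuous_subtype_val.comp (continuous_apply j)))).sub
      (continuous_integral_tupleLoss hP M))

variable [CompleteSpace E]

/-- With high probability, for all bounded quantizers, most block means of the loss are close to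
its expectation. -/
theorem measure_exists_tuple_le (hP : Integrable (fun x => ‖x‖ ^ 2) P)
    (hM : 0 < M) {ℓ m : ℕ} (hℓ : 0 < ℓ) (hm : 0 < m) :
    (Measure.pi fun _ : Fin ℓ => Measure.pi fun _ : Fin m => P)
      {Y | ∃ a : Fin k → E, (∀ j, ‖a j‖ ≤ M) ∧ ℓ ≤ 2 * (Finset.univ.filter fun j =>
        accuracy (2 * M * √(∫ x, ‖x‖ ^ 2 ∂P) + M ^ 2) k ℓ m <
          |blockDev P (tupleLoss a) (Y j)|).card} ≤
      ENNReal.ofReal (Real.exp (-(ℓ / 8))) := by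
  have : Nonempty (Metric.closedBall (0 : E) M) := ⟨⟨0, by simpa using hM.le⟩⟩
  set r := accuracy (2 * M * √(∫ x, ‖x‖ ^ 2 ∂P) + M ^ 2) k ℓ m with hr
  let S := Fin k → Metric.closedBall (0 : E) M
  let d : ℕ → S := TopologicalSpace.denseSeq S
  let B : ℕ → Set (Fin ℓ → Fin m → E) := fun n => {Y | ∃ s : Fin (n + 1),
    ℓ ≤ 2 * (Finset.univ.filter fun j =>
      r < |blockDev P (tupleLoss fun i => (d s i : E)) (Y j)|).card}
  have hB : Monotone B := fun n n' hn Y ⟨s, hs⟩ => ⟨Fin.castLE (by omega) s, hs⟩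
  have hBn : ∀ n, (Measure.pi fun _ : Fin ℓ => Measure.pi fun _ : Fin m => P) (B n) ≤
      ENNReal.ofReal (Real.exp (-(ℓ / 8))) := fun n =>
    measure_exists_finite_tuple_le hP hM
      (a := fun (s : Fin (n + 1)) i => (d s i : E)) (fun s i => mem_closedBall_zero_iff.1 (d s i).2) hℓ hm
  refine (measure_mono (t := ⋃ n, B n) ?_).trans ?_
  · rintro Y ⟨a, ha, hcard⟩
    let s₀ : S := fun j => ⟨a j, by simpa using ha j⟩
    set J := Finset.univ.filter fun j => r < |blockDev P (tupleLoss a) (Y j)| with hJ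
    -- A strict deviation persists under small moves of the centres, so some tuple of the dense
    -- sequence deviates on every block of `J`.
    have hopen : IsOpen (⋂ j ∈ J, {s : S | r < |blockDev P (tupleLoss fun i => (s i : E)) (Y j)|}) :=
      isOpen_biInter_finset fun j _ =>
        isOpen_lt continuous_const (continuous_blockDev_tupleLoss hP M (Y j)).abs
    obtain ⟨n, hn⟩ := (TopologicalSpace.denseRange_denseSeq S).exists_mem_open hopen
      ⟨s₀, Set.mem_iInter₂.2 fun j hj => (Finset.mem_filter.1 hj).2⟩
    refine Set.mem_iUnion.2 ⟨n, Fin.last n, hcard.trans ?_⟩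
    refine Nat.mul_le_mul_left 2 (Finset.card_le_card fun j hj => ?_)
    exact Finset.mem_filter.2 ⟨Finset.mem_univ j, Set.mem_iInter₂.1 hn j hj⟩
  -- The bound does not depend on `n`, and continuity along increasing unions holds without
  -- measurability of the sets.
  · rw [hB.measure_iUnion]
    exact iSup_le hBn

end UniformDeviation

/-! ### The sample arranged in independent blocks. -/

section Sampling

variable {E Ω : Type*} [MeasurableSpace E] [MeasurableSpace Ω]

/-- The index in the sample of the observation number `i` of block `j`. -/
def blockIndex {N ℓ m : ℕ} (h : ℓ * m ≤ N) (j : Fin ℓ) (i : Fin m) : Fin N :=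
  ⟨j * m + i, lt_of_lt_of_le (by
    calc (j : ℕ) * m + i < j * m + m := by have := i.2; omega
      _ = (j + 1) * m := by ring
      _ ≤ ℓ * m := Nat.mul_le_mul_right m j.2) h⟩

theorem blockIndex_injective {N ℓ m : ℕ} (h : ℓ * m ≤ N) :
    Function.Injective fun p : (_ : Fin ℓ) × Fin m => blockIndex h p.1 p.2 := by
  rintro ⟨j, i⟩ ⟨j', i'⟩ he
  have he : (j : ℕ) * m + i = j' * m + i' := congrArg Fin.val he
  have hm : 0 < m := i.pos
  have hj : (j : ℕ) = j' := by
    have h₁ : ((j : ℕ) * m + i) / m = j := by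
      rw [add_comm, Nat.add_mul_div_right _ _ hm, Nat.div_eq_of_lt i.2, zero_add]
    have h₂ : ((j' : ℕ) * m + i') / m = j' := by
      rw [add_comm, Nat.add_mul_div_right _ _ hm, Nat.div_eq_of_lt i'.2, zero_add]
    rw [← h₁, ← h₂, he]
  have hj' : j = j' := Fin.ext hj
  subst hj'
  have : i = i' := Fin.ext (by omega)
  subst this
  rfl

theorem sum_block {N ℓ m : ℕ} (h : ℓ * m ≤ N) (j : Fin ℓ) (g : Fin N → ℝ) :
    ∑ i ∈ block m j, g i = ∑ i : Fin m, g (blockIndex h j i) := by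
  symm
  refine Finset.sum_bij (fun i _ => blockIndex h j i) (fun i _ => ?_) (fun i _ i' _ he => ?_)
    (fun n hn => ?_) fun _ _ => rfl
  · have := i.2
    simp only [block, blockIndex, Finset.mem_filter, Finset.mem_univ, true_and, add_mul]
    omega
  · have : (j : ℕ) * m + i = j * m + i' := congrArg Fin.val he
    exact Fin.ext (by omega)
  · simp only [block, Finset.mem_filter, Finset.mem_univ, true_and, add_mul] at hn
    exact ⟨⟨n - j * m, by omega⟩, Finset.mem_univ _, Fin.ext (by simp [blockIndex]; omega)⟩

theorem hasLaw_blocks {P : Measure E} [IsProbabilityMeasure P] {μ : Measure Ω}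
    [IsProbabilityMeasure μ] {N ℓ m : ℕ} (h : ℓ * m ≤ N) {X : Fin N → Ω → E}
    (hX : ∀ i, HasLaw (X i) P μ) (hind : iIndepFun X μ) :
    HasLaw (fun ω (j : Fin ℓ) (i : Fin m) => X (blockIndex h j i) ω)
      (Measure.pi fun _ => Measure.pi fun _ => P) μ := by
  have hae : ∀ i, AEMeasurable (X i) μ := fun i => (hX i).aemeasurable
  refine ⟨aemeasurable_pi_iff.2 fun j => aemeasurable_pi_iff.2 fun i => hae _, ?_⟩
  have h₁ := (iIndepFun_iff_map_fun_eq_pi_map fun p => hae _).1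
    (hind.precomp (blockIndex_injective h))
  simp only [(hX _).map_eq] at h₁
  have h₂ := Measure.infinitePi_map_piCurry (ι := Fin ℓ) (κ := fun _ => Fin m)
    (X := fun _ _ => E) (fun _ _ => P)
  simp only [Measure.infinitePi_eq_pi] at h₂
  rw [← h₂, ← h₁, AEMeasurable.map_map_of_aemeasurable]
  · rfl
  · exact (MeasurableEquiv.measurable _).aemeasurable
  · exact aemeasurable_pi_iff.2 fun p => hae _

end Sampling

/-! ### Constants and rates. -/

section Bounds

variable {E : Type*} [NormedAddCommGroup E] [InnerProductSpace ℝ E]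

theorem medianOfMeans_eq {E : Type*} {N ℓ : ℕ} [NeZero ℓ] (h : ℓ * (N / ℓ) ≤ N) (x : Fin N → E)
    (f : E → ℝ) :
    medianOfMeans ℓ x f =
      median fun j : Fin ℓ => ((N / ℓ : ℕ) : ℝ)⁻¹ * ∑ i, f (x (blockIndex h j i)) := by
  simp only [medianOfMeans, sum_block h]

theorem blockDev_eq {E : Type*} [MeasurableSpace E] (P : Measure E) {m : ℕ} (hm : 0 < m) (f : E → ℝ)
    (y : Fin m → E) :
    blockDev P f y = (m : ℝ)⁻¹ * ∑ i, f (y i) - ∫ x, f x ∂P := by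
  have : (m : ℝ) ≠ 0 := by exact_mod_cast hm.ne'
  rw [blockDev, Finset.sum_sub_distrib, Finset.sum_const, Finset.card_univ, Fintype.card_fin,
    nsmul_eq_mul, mul_sub, inv_mul_cancel_left₀ this]

theorem distortion_eq [SecondCountableTopology E] [MeasurableSpace E] [BorelSpace E]
    {P : Measure E} [IsProbabilityMeasure P] (hP : Integrable (fun x => ‖x‖ ^ 2) P) {k : ℕ}
    [NeZero k] {A : Finset E} (hA : A.Nonempty) {M : ℝ} {a : Fin k → E} (ha : ∀ j, ‖a j‖ ≤ M)
    (hl : loss A = tupleLoss a) :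
    distortion P A = ∫ x, ‖x‖ ^ 2 ∂P + ∫ x, tupleLoss a x ∂P := by
  simp only [distortion, iInf_norm_sub_sq hA, hl]
  exact integral_add hP ((memLp_tupleLoss hP ha).integrable (by norm_num))

theorem le_numBlocks {δ : ℝ} (hδ : 0 < δ) : Real.exp (-((numBlocks δ : ℝ) / 8)) ≤ δ := by
  have h₁ : Real.log (2 / δ) ≤ (numBlocks δ : ℝ) / 8 := by
    have := Nat.le_ceil (Real.log (2 / δ))
    rw [numBlocks]
    push_cast
    linarith
  calc Real.exp (-((numBlocks δ : ℝ) / 8)) ≤ Real.exp (-Real.log (2 / δ)) := by gcongr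
    _ = δ / 2 := by rw [Real.exp_neg, Real.exp_log (by positivity), inv_div]
    _ ≤ δ := by linarith

/-- The number of blocks is below `8 * log (1 / δ) + 8 * log 2 + 9`; since `1 ≤ k`, the constant
part is absorbed by `16 * k ^ 2`. -/
theorem sqrt_numBlocks_le {δ : ℝ} (hδ : 0 < δ) (hδ1 : δ < 1) {k : ℕ} (hk : 1 ≤ k) :
    √(numBlocks δ : ℝ) ≤ 4 * (k + √(Real.log (1 / δ))) := by
  have hL : 0 ≤ Real.log (1 / δ) := Real.log_nonneg ((one_le_div hδ).2 hδ1.le)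
  have hk' : (1 : ℝ) ≤ k := by exact_mod_cast hk
  have h₁ : Real.log (2 / δ) = Real.log 2 + Real.log (1 / δ) := by
    rw [← Real.log_mul (by norm_num) (by positivity)]
    congr 1
    ring
  have h₂ := Real.log_two_lt_d9
  have h₃ := Real.log_two_gt_d9
  have h₄ := Nat.ceil_lt_add_one (a := Real.log (2 / δ)) (by linarith)
  have h₅ : (numBlocks δ : ℝ) = 8 * ⌈Real.log (2 / δ)⌉₊ + 1 := by simp [numBlocks]
  refine Real.sqrt_le_iff.2 ⟨by positivity, ?_⟩
  have h₆ := Real.sq_sqrt hL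
  nlinarith [Real.sqrt_nonneg (Real.log (1 / δ)), mul_nonneg (Nat.cast_nonneg (α := ℝ) k)
    (Real.sqrt_nonneg (Real.log (1 / δ)))]

theorem rate_eq (L : ℝ) (k N : ℕ) :
    (k / √(N : ℝ) + √(L / N)) = (k + √L) / √(N : ℝ) := by
  rw [Real.sqrt_div' _ (Nat.cast_nonneg N), add_div]

theorem accuracy_le {V δ : ℝ} (hV : 0 ≤ V) (hδ : 0 < δ) (hδ1 : δ < 1) {k N : ℕ} (hk : 1 ≤ k)
    (hN : numBlocks δ ≤ N) :
    accuracy V k (numBlocks δ) (N / numBlocks δ) ≤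
      128 * V * (k / √(N : ℝ) + √(Real.log (1 / δ) / N)) := by
  have hs := sqrt_numBlocks_le hδ hδ1 hk
  rw [rate_eq]
  set ℓ := numBlocks δ
  set m := N / ℓ with hmdef
  have hℓ : 0 < ℓ := NeZero.pos ℓ
  have hm : 0 < m := Nat.div_pos hN hℓ
  -- Fewer than `ℓ` observations are discarded, so even a factor `2` would do; `4` has an integral
  -- square root.
  have hN2 : N ≤ 4 * (ℓ * m) := by
    have h₁ := Nat.div_add_mod N ℓ
    have h₂ := Nat.mod_lt N hℓ
    have h₃ : ℓ * 1 ≤ ℓ * m := Nat.mul_le_mul_left ℓ hm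
    rw [← hmdef] at h₁
    omega
  have hN0 : 0 < √(N : ℝ) := Real.sqrt_pos.2 (by exact_mod_cast hℓ.trans_le hN)
  have sℓ : 0 < √(ℓ : ℝ) := Real.sqrt_pos.2 (by exact_mod_cast hℓ)
  have sm : 0 < √(m : ℝ) := Real.sqrt_pos.2 (by exact_mod_cast hm)
  have hsN : √(N : ℝ) ≤ 2 * (√ℓ * √m) := by
    refine Real.sqrt_le_iff.2 ⟨by positivity, ?_⟩
    rw [mul_pow, mul_pow, Real.sq_sqrt (by positivity), Real.sq_sqrt (by positivity)]
    have : (N : ℝ) ≤ 4 * (ℓ * m) := by exact_mod_cast hN2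
    linarith
  have hL := Real.sqrt_nonneg (Real.log (1 / δ))
  set R := √(Real.log (1 / δ))
  have h₁ : 8 * V / √m ≤ 64 * V * ((k + R) / √N) := by
    rw [mul_div_assoc', div_le_div_iff₀ sm hN0]
    calc 8 * V * √N ≤ 8 * V * (2 * (4 * (k + R) * √m)) := by
          gcongr
          exact hsN.trans (by gcongr)
      _ = _ := by ring
  have h₂ : 32 * k * V / (√ℓ * √m) ≤ 64 * V * ((k + R) / √N) := by
    rw [mul_div_assoc', div_le_div_iff₀ (by positivity) hN0]
    calc 32 * k * V * √N ≤ 32 * (k + R) * V * (2 * (√ℓ * √m)) := by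
          gcongr
          linarith
      _ = _ := by ring
  rw [accuracy]
  linarith

theorem one_le_rate {δ : ℝ} (hδ : 0 < δ) (hδ1 : δ < 1) {k N : ℕ} (hk : 1 ≤ k) (hN1 : 1 ≤ N)
    (hN : N < numBlocks δ) : 1 ≤ 4 * (k / √(N : ℝ) + √(Real.log (1 / δ) / N)) := by
  have hs := sqrt_numBlocks_le hδ hδ1 hk
  have hN0 : 0 < √(N : ℝ) := Real.sqrt_pos.2 (by exact_mod_cast hN1)
  rw [rate_eq, mul_div_assoc', one_le_div hN0]
  exact (Real.sqrt_le_sqrt (by exact_mod_cast hN.le)).trans hs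

end Bounds

end KMeans

/-! ### The risk bound. -/

theorem mainTheorem5 :
    ∃ C : ℝ, 0 < C ∧
      ∀ (E : Type*) [NormedAddCommGroup E] [InnerProductSpace ℝ E] [CompleteSpace E]
        [TopologicalSpace.SeparableSpace E] [MeasurableSpace E] [BorelSpace E]
        (k N : ℕ) (M δ : ℝ), 1 ≤ k → 1 ≤ N → 0 ≤ M → 0 < δ → δ < 1 →
        -- the estimator is well defined: on every sample there is a minimizer
        (∀ x : Fin N → E, ∃ A : Finset E, KMeans.IsMOMMinimizer k M δ x A) ∧
        -- every choice of minimizers satisfies the bound with probability at least `1 - δ`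
        ∀ Ahat : (Fin N → E) → Finset E, (∀ x, KMeans.IsMOMMinimizer k M δ x (Ahat x)) →
          ∀ (P : Measure E) [IsProbabilityMeasure P], Integrable (fun x => ‖x‖ ^ 2) P →
          ∀ Aopt : Finset E, KMeans.IsOptimal P k Aopt → (∀ a ∈ Aopt, ‖a‖ ≤ M) →
          ∀ (Ω : Type*) [MeasurableSpace Ω] (μ : Measure Ω) [IsProbabilityMeasure μ]
            (X : Fin N → Ω → E), (∀ i, HasLaw (X i) P μ) → iIndepFun X μ →
            μ {ω | ¬ (KMeans.distortion P (Ahat fun i => X i ω) - KMeans.distortion P Aopt ≤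
                C * (M * (M + √(∫ x, ‖x‖ ^ 2 ∂P)) *
                  (k / √(N : ℝ) + √(Real.log (1 / δ) / N))))} ≤ ENNReal.ofReal δ := by
  -- Two gaps of at most `128 * V * T` each, and `V ≤ 2 * (M * (M + σ))`.
  refine ⟨512, by norm_num, ?_⟩
  intro E _ _ _ _ _ _ k N M δ hk hN hM hδ hδ1
  refine ⟨fun x => KMeans.exists_isMOMMinimizer hk hM δ x, ?_⟩
  intro Ahat hAhat P _ hP Aopt hopt hoptM Ω _ μ _ X hX hind
  have : SecondCountableTopology E := UniformSpace.secondCountable_of_separable E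
  have : NeZero k := ⟨by omega⟩
  set σ := √(∫ x, ‖x‖ ^ 2 ∂P) with hσ
  have hσ0 : 0 ≤ σ := Real.sqrt_nonneg _
  set V := 2 * M * σ + M ^ 2 with hVdef
  have hV : 0 ≤ V := by positivity
  have hVB : V ≤ 2 * (M * (M + σ)) := by nlinarith [sq_nonneg M]
  set T := k / √(N : ℝ) + √(Real.log (1 / δ) / N) with hT
  have hT0 : 0 ≤ T := by positivity
  obtain ⟨b, hb, hbl⟩ := KMeans.exists_tuple_of_mem_boundedQuantizers
    (show Aopt ∈ KMeans.boundedQuantizers E k M from ⟨hopt.1, hoptM⟩)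
  have hDopt := KMeans.distortion_eq hP hopt.1.1 hb hbl
  have hgood : ∀ ω,
      (∀ a : Fin k → E, (∀ j, ‖a j‖ ≤ M) → KMeans.loss (Ahat fun i => X i ω) =
        KMeans.tupleLoss a → ∫ x, KMeans.tupleLoss a x ∂P - ∫ x, KMeans.tupleLoss b x ∂P ≤
          256 * V * T) →
      KMeans.distortion P (Ahat fun i => X i ω) - KMeans.distortion P Aopt ≤
        512 * (M * (M + σ) * T) := by
    intro ω h
    have hmem := (hAhat fun i => X i ω).1
    obtain ⟨a, ha, hal⟩ := KMeans.exists_tuple_of_mem_boundedQuantizers hmem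
    rw [KMeans.distortion_eq hP hmem.1.1 ha hal, hDopt]
    have h₁ := h a ha hal
    have h₂ := mul_le_mul_of_nonneg_right hVB hT0
    linarith
  -- Degenerate cases: `r` would vanish, or the blocks are empty. The deterministic bound `V` on
  -- expected losses suffices: `V = 0` in the first case, `T ≥ 1 / 4` in the second.
  by_cases htriv : M = 0 ∨ N < KMeans.numBlocks δ
  · refine le_of_eq_of_le (measure_mono_null (t := ∅) (fun ω hω => ?_) measure_empty) zero_le
    refine hω (hgood ω fun a ha _ => ?_)
    have h₁ := (abs_le.1 (KMeans.abs_integral_tupleLoss_le hP hM ha)).2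
    have h₂ := (abs_le.1 (KMeans.abs_integral_tupleLoss_le hP hM hb)).1
    rcases htriv with h0 | hlt
    · have hV0 : V = 0 := by rw [hVdef, h0]; ring
      rw [← hσ, ← hVdef, hV0] at h₁ h₂
      rw [hV0]
      linarith
    · have h₃ := mul_le_mul_of_nonneg_left (KMeans.one_le_rate hδ hδ1 hk hN hlt) hV
      have h₄ := mul_nonneg hV hT0
      rw [← hσ, ← hVdef] at h₁ h₂
      rw [← hT] at h₃
      linarith
  · push Not at htriv
    obtain ⟨hM0, hNℓ⟩ := htriv
    have hMpos : 0 < M := lt_of_le_of_ne hM hM0.symm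
    have hℓ : 0 < KMeans.numBlocks δ := NeZero.pos _
    have hm : 0 < N / KMeans.numBlocks δ := Nat.div_pos hNℓ hℓ
    have hle : KMeans.numBlocks δ * (N / KMeans.numBlocks δ) ≤ N := Nat.mul_div_le _ _
    have hlaw := KMeans.hasLaw_blocks hle hX hind
    have hbad := KMeans.measure_exists_tuple_le (k := k) hP hMpos hℓ hm
    rw [← hσ, ← hVdef] at hbad
    have hacc := KMeans.accuracy_le hV hδ hδ1 hk hNℓ
    rw [← hT] at hacc
    set r := KMeans.accuracy V k (KMeans.numBlocks δ) (N / KMeans.numBlocks δ) with hr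
    rw [← hlaw.map_eq] at hbad
    refine le_trans ?_ (hbad.trans (ENNReal.ofReal_le_ofReal (KMeans.le_numBlocks hδ)))
    -- This inequality holds for arbitrary sets, so neither the bad event nor the choice of
    -- minimizers need be measurable.
    refine le_trans (measure_mono fun ω hω => ?_) (Measure.le_map_apply hlaw.aemeasurable _)
    by_contra hω'
    refine hω (hgood ω fun a ha hal => ?_)
    have hclose : ∀ c : Fin k → E, (∀ j, ‖c j‖ ≤ M) →
        |KMeans.medianOfMeans (KMeans.numBlocks δ) (fun i => X i ω) (KMeans.tupleLoss c) -
          ∫ x, KMeans.tupleLoss c x ∂P| ≤ r := by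
      intro c hc
      rw [KMeans.medianOfMeans_eq hle]
      refine KMeans.abs_median_sub_le ?_
      by_contra hcard
      refine hω' ⟨c, hc, ?_⟩
      simpa only [KMeans.blockDev_eq P hm, not_lt] using hcard
    have h₁ := (abs_le.1 (hclose a ha)).1
    have h₂ := (abs_le.1 (hclose b hb)).2
    have h₃ : KMeans.medianOfMeans (KMeans.numBlocks δ) (fun i => X i ω)
        (KMeans.loss (Ahat fun i => X i ω)) ≤
        KMeans.medianOfMeans (KMeans.numBlocks δ) (fun i => X i ω) (KMeans.loss Aopt) :=
      (hAhat fun i => X i ω).2 ⟨hopt.1, hoptM⟩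
    rw [hal, hbl] at h₃
    linarith
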